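/- Let $n\ge 1$ and $0\le k\le n$, put $s=\min(k,n-k)$, let $X$ be the set of $k$-subsets of $\{1,\dots,n\}$, and let $\mathcal F$ be the space of functions $X\to\mathbb C$ with the inner product for which the delta functions are orthonormal; denote by $B_0$ the basis of delta functions. The group $S_n$ acts on $\mathcal F$ by $\sigma f=f\circ\sigma^{-1}$; for $1\le i\le n$ let $S_i\subseteq S_n$ be the subgroup fixing $i+1,\dots,n$, and for $0\le a\le i/2$ let $\mathcal F_{i,(i-a,a)}$ be the isotypic component of $\mathcal F$ under $S_i$ belonging to the irreducible (Specht) representation of shape $(i-a,a)$. Put $\mathcal F_a=\mathcal F_{n,(n-a,a)}$. Every $f\in\mathcal F$ can be written in exactly one way as $f=\sum_{a=0}^{s}f_a$ with $f_a\in\mathcal F_a$; the numbers $\|f_a\|^2$ are the weights of $f$. Identify a $k$-subset with the word of length $n$ in the letters $1,2$ that has the letter $1$ exactly at the elements of the subset. For $1\le i\le n$, consider the pairs $(T,w)$ where $w$ is a word of length $n-i$ in the letters $1,2$ with $k-r$ letters $1$, $0\le r\le k$, and $T$ is a standard Young tableau with $i$ boxes of shape $(i-a,a)$, $0\le a\le\min(r,i-r)$,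 regarded as a chain $\lambda_1\nearrow\dots\nearrow\lambda_i$ of Young diagrams. Let $\mathcal F^{w}$ be the span of the delta functions of the words that end in $w$, and $\mathcal F^w_T=\mathcal F_{1,\lambda_1}\cap\dots\cap\mathcal F_{i,\lambda_i}\cap\mathcal F^w$. There are orthonormal bases $B_1,\dots,B_n$ of $\mathcal F$ such that $B_i$ consists of one vector of $\mathcal F^w_T$ for each such pair $(T,w)$, and $B_1=B_0$ (so $B_n$ is a Gelfand–Tsetlin basis). For $2\le i\le n$ let $[B_{i-1}]_{B_i}$ be the matrix whose columns are the coordinates of the elements of $B_{i-1}$ in the basis $B_i$. Count as one operation on complex numbers a multiplication together with an addition, $u+vw$ or $u+v\bar v$. Then, for each pair $(n,k)$, there is a straight-line program with at most $(2n-1)\binom nk$ operations which, for every such choice of $B_1,\dots,B_n$ and every $f\in\mathcal F$, takes as input the entries of the column vector $[f]_{B_0}$ and the entries of the matrices $[B_{i-1}]_{B_i}$, $i=2,\dots,n$, and whose output consists of all the weights $\|f_a\|^2$, $a=0,\dots,s$. (Each operand of an operation is $0$, an input or the result of an earlier operation.) -/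

import Mathlib

noncomputable section

namespace JohnsonFFT

/-! ### Functions on the Johnson graph

The ground set `{1, …, n}` is `Fin n`, so the element `j` of the text is `j - 1` here. -/

/-- The set `X` of `k`-subsets of an `n`-set. -/
abbrev KSet (n k : ℕ) : Type := Set.powersetCard (Fin n) k

/-- The space `𝓕` of complex functions on `X`, with the inner product for which the delta
functions are orthonormal. -/
abbrev FunSpace (n k : ℕ) : Type := EuclideanSpace ℂ (KSet n k)

/-- The delta function at `x`. -/
def delta {n k : ℕ} (x : KSet n k) : FunSpace n k :=
  open Classical in EuclideanSpace.single x 1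

/-- The action `σ f = f ∘ σ⁻¹` of the symmetric group on functions. -/
def permRep (n k : ℕ) : Representation ℂ (Equiv.Perm (Fin n)) (FunSpace n k) where
  toFun σ :=
    { toFun := fun f => WithLp.toLp 2 fun x => f (σ⁻¹ • x)
      map_add' := fun f g => by ext x; simp
      map_smul' := fun c f => by ext x; simp }
  map_one' := by ext f x; simp
  map_mul' σ τ := by ext f x; simp [mul_smul]

/-- `𝓕` as a representation of `S_i`, acting on the first `i` elements of the ground set and
fixing the last `n - i`. -/
def stageRep (n k i : ℕ) (hi : i ≤ n) : Representation ℂ (Equiv.Perm (Fin i)) (FunSpace n k) :=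
  (permRep n k).comp (Equiv.Perm.viaEmbeddingHom (Fin.castLEEmb hi))

/-! ### The irreducible representation of `S_m` of shape `(m - a, a)`

A tabloid of shape `(m - a, a)` is determined by its second row, an `a`-subset of the ground set,
so the permutation module on tabloids is `FunSpace m a`. We use the tableau whose first row is
`0, …, m - a - 1` and whose second row is `m - a, …, m - 1`. -/

/-- The column of the entry `x` in the tableau. -/
def column (m a : ℕ) (x : Fin m) : ℕ := if (x : ℕ) < m - a then x else x - (m - a)

/-- The second row of the tableau. -/
def secondRow (m a : ℕ) : Finset (Fin m) := Finset.univ.filter fun x => m - a ≤ (x : ℕ)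

/-- The column stabilizer of the tableau. -/
def columnGroup (m a : ℕ) : Finset (Equiv.Perm (Fin m)) :=
  Finset.univ.filter fun π => ∀ x, column m a (π x) = column m a x

/-- The polytabloid of the tableau: the signed sum of the translates, by the column stabilizer,
of the tabloid of the tableau. -/
def polytabloid (m a : ℕ) : FunSpace m a :=
  WithLp.toLp 2 fun x => ∑ π ∈ columnGroup m a,
    if (x : Finset (Fin m)) = (secondRow m a).image π then ((Equiv.Perm.sign π : ℤ) : ℂ) else 0

/-- The Specht module of shape `(m - a, a)` (for `2 * a ≤ m`): the span of all polytabloids, that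
is, of all translates of the one above. -/
def specht (m a : ℕ) : Subrepresentation (permRep m a) where
  toSubmodule := Submodule.span ℂ (Set.range fun σ => permRep m a σ (polytabloid m a))
  apply_mem_toSubmodule := by
    intro g v hv
    induction hv using Submodule.span_induction with
    | mem x hx =>
      obtain ⟨σ, rfl⟩ := hx
      exact Submodule.subset_span ⟨g * σ, by simp⟩
    | zero => simp
    | add x y _ _ hx hy => rw [map_add]; exact add_mem hx hy
    | smul c x _ hx => rw [map_smul]; exact Submodule.smul_mem _ c hx

/-- The isotypic component `𝓕_{i, λ}` of `𝓕` under `S_i`, for `λ = (i - a, a)`: the sum of all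
subrepresentations of `𝓕` that are isomorphic to the Specht module of shape `λ`. -/
def isotypic (n k i : ℕ) (hi : i ≤ n) (a : ℕ) : Submodule ℂ (FunSpace n k) :=
  ⨆ (φ : (specht i a).toRepresentation.IntertwiningMap (stageRep n k i hi))
    (_ : Function.Injective φ.toLinearMap), LinearMap.range φ.toLinearMap

/-- `f = ∑ f_a`, with `f_a` in the isotypic component of shape `(n - a, a)` under `S_n`, where `a`
runs from `0` to `s = min k (n - k)`. -/
def IsDecomposition {n k : ℕ} (f : FunSpace n k) (g : Fin (min k (n - k) + 1) → FunSpace n k) :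
    Prop :=
  (∀ a : Fin (min k (n - k) + 1), g a ∈ isotypic n k n le_rfl (a : ℕ)) ∧ f = ∑ a, g a

/-! ### The intermediate bases -/

/-- The labels of the basis `B_i`: pairs `(T, w)` of a standard tableau `T` with `i` boxes and at
most two rows, and a word `w` of length `n - i` in the letters `1`, `2`. -/
structure Label (n k i : ℕ) where
  /-- The entries in the second row of `T`. -/
  second : Finset (Fin n)
  /-- The places, among the last `n - i`, where `w` has the letter `1`. -/
  ones : Finset (Fin n)
  second_lt : ∀ x ∈ second, (x : ℕ) < i
  le_ones : ∀ x ∈ ones, i ≤ (x : ℕ)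
  /-- For every `j ≤ i` the entries `1, …, j` fill a Young diagram. -/
  standard : ∀ j ≤ i, 2 * (second.filter fun x : Fin n => (x : ℕ) < j).card ≤ j
  /-- `a ≤ r`, for the shape `(i - a, a)` of `T` and the number `r = k - #ones` of letters `1`
  missing from `w`. -/
  shape_le : second.card + ones.card ≤ k
  /-- `a ≤ i - r`. -/
  shape_le' : second.card + k ≤ i + ones.card

namespace Label

theorem ext_pair {n k i : ℕ} :
    Function.Injective fun l : Label n k i => (l.second, l.ones) := by
  rintro ⟨⟩ ⟨⟩ h
  simp only [Prod.mk.injEq] at h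
  obtain ⟨rfl, rfl⟩ := h
  rfl

instance (n k i : ℕ) : Fintype (Label n k i) := Fintype.ofInjective _ ext_pair

/-- The length of the second row of the `j`-th shape `λ_j = (j - a_j, a_j)` in the chain
`λ_1 ↗ ⋯ ↗ λ_i` that is the tableau. -/
def secondLength {n k i : ℕ} (l : Label n k i) (j : ℕ) : ℕ :=
  (l.second.filter fun x : Fin n => (x : ℕ) < j).card

/-- The subspace `𝓕^w`, spanned by the delta functions of the `k`-sets whose word ends in `w`. -/
def wordSpace {n k i : ℕ} (l : Label n k i) : Submodule ℂ (FunSpace n k) :=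
  Submodule.span ℂ
    (delta '' {x : KSet n k | ∀ y : Fin n, i ≤ (y : ℕ) → (y ∈ x ↔ y ∈ l.ones)})

/-- The subspace `𝓕^w_{λ_1 ↗ ⋯ ↗ λ_i} = 𝓕_{1, λ_1} ∩ ⋯ ∩ 𝓕_{i, λ_i} ∩ 𝓕^w`. -/
def space {n k i : ℕ} (hi : i ≤ n) (l : Label n k i) : Submodule ℂ (FunSpace n k) :=
  (⨅ (j : ℕ) (_ : 1 ≤ j) (hj : j ≤ i), isotypic n k j (hj.trans hi) (l.secondLength j)) ⊓
    l.wordSpace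

end Label

/-- A choice of the orthonormal bases `B_1, …, B_n` of `𝓕`; the basis `B_{i+1}` is `basis i`.
Each is made of unit vectors of the subspaces `𝓕^w_{λ_1 ↗ ⋯ ↗ λ_i}`, and `B_1` is the basis `B_0`
of delta functions. The basis `B_n` is a Gelfand-Tsetlin basis of `𝓕`. -/
structure IntermediateBases (n k : ℕ) where
  basis : ∀ i : Fin n, OrthonormalBasis (Label n k (i + 1)) ℂ (FunSpace n k)
  mem_space : ∀ (i : Fin n) (l : Label n k (i + 1)), basis i l ∈ l.space i.isLt
  first : ∀ (h : 0 < n) (l : Label n k (0 + 1)), ∃ x : KSet n k, basis ⟨0, h⟩ l = delta x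

/-- The change of basis matrix `[B_{i+1}]_{B_{i+2}}`, whose columns are the coordinates of the
elements of `B_{i+1}` in the basis `B_{i+2}`. -/
def IntermediateBases.factor {n k : ℕ} (B : IntermediateBases n k) (i : ℕ) (hi : i + 1 < n) :
    Matrix (Label n k (i + 1 + 1)) (Label n k (i + 1)) ℂ :=
  (B.basis ⟨i + 1, hi⟩).toBasis.toMatrix (B.basis ⟨i, Nat.lt_of_succ_lt hi⟩)

/-! ### Straight-line programs

One operation is one complex multiplication together with one addition. -/

/-- What an operation may read: the number `0`, an input variable, or the result of the `j`-th
operation (an operation that has not been performed yet reads as `0`). -/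
inductive Operand (I : Type) where
  | zero
  | input (v : I)
  | result (j : ℕ)

/-- An operation `u + v * w`, or `u + v * conj v = u + |v|²`. -/
inductive Op (I : Type) where
  | mulAdd (u v w : Operand I)
  | normSqAdd (u v : Operand I)

/-- The value of an operand, given the input and the list of the results so far. -/
def Operand.eval {I : Type} (inp : I → ℂ) (mem : List ℂ) : Operand I → ℂ
  | .zero => 0
  | .input v => inp v
  | .result j => mem.getD j 0

/-- The result of an operation, given the input and the list of the results so far. -/
def Op.eval {I : Type} (inp : I → ℂ) (mem : List ℂ) : Op I → ℂ
  | .mulAdd u v w => u.eval inp mem + v.eval inp mem * w.eval inp mem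
  | .normSqAdd u v => u.eval inp mem + v.eval inp mem * (starRingEnd ℂ) (v.eval inp mem)

/-- A program with inputs `I` and outputs `O`: the list of the operations, performed in this
order, and for each output where to find it. -/
structure Program (I O : Type) where
  ops : List (Op I)
  out : O → Operand I

/-- The list of the results of all the operations. -/
def Program.results {I O : Type} (P : Program I O) (inp : I → ℂ) : List ℂ :=
  P.ops.foldl (fun mem c => mem ++ [c.eval inp mem]) []

/-- The outputs of the program. -/
def Program.run {I O : Type} (P : Program I O) (inp : I → ℂ) (o : O) : ℂ :=
  (P.out o).eval inp (P.results inp)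

/-- The number of operations. -/
def Program.cost {I O : Type} (P : Program I O) : ℕ := P.ops.length

/-- The input variables: the entries of `[f]_{B_0}` and those of the matrices
`[B_{i+1}]_{B_{i+2}}`. -/
inductive InputVar (n k : ℕ) where
  | coord (x : KSet n k)
  | entry (i : ℕ) (hi : i + 1 < n) (row : Label n k (i + 1 + 1)) (col : Label n k (i + 1))

/-- The values of the input variables. -/
def inputOf {n k : ℕ} (B : IntermediateBases n k) (f : FunSpace n k) : InputVar n k → ℂ
  | .coord x => f x
  | .entry i hi row col => B.factor i hi row col

end JohnsonFFT

end

noncomputable section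

namespace JohnsonFFT

open Finset Equiv
open scoped Pointwise

/-! ### Raising and lowering operators on functions of finite sets -/

/-! The algorithm passes through the coordinates of `f` in `B_1`, ..., `B_n`, and it is cheap
because each change of basis is sparse. Let `(T, w)` label a vector of `B_{i+1}` and `(T', w')` one
of `B_i`. If the chains of shapes differ at some `j ≤ i`, the vectors lie in different, hence
orthogonal, isotypic components under `S_j`; if `w` and `w'` disagree at a common place, their
supports are disjoint. So the inner product can be nonzero only if `T'` is `T` without its last box
and `w'` is `w` preceded by one letter: at most two candidates, known from the labels alone. A basis
has `n.choose k` vectors, so each of the `n - 1` steps costs at most `2 * n.choose k` operations.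
The coordinates in `B_1` are the input, and the squares of the last coordinates, grouped by shape,
cost `n.choose k` more.

The orthogonality comes from the sum of the transpositions of `S_j`, which is self-adjoint and acts
on the component of shape `(j - a, a)` by the scalar `eigval j a`; these scalars are distinct for `2
* a ≤ j`.

For the existence of the bases, `gtVec` builds an explicit eigenvector of all these sums for each
standard tableau; raising it and adjoining `w` gives a vector for each label. Nonvanishing is the
`sl_2` argument for `raise` and `lower`. The vectors are orthogonal, and there are enough of them by
injections between label sets. That they lie in isotypic components, and not only in eigenspaces,
rests on `harmonic_le_specht`: the Specht module is the whole kernel of the lowering operator.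

Functions on `Finset ℕ` serve all levels and all set sizes at once; `restrict` and `extend`
translate to and from `FunSpace`. -/

/-- The raising operator of the first `j` elements. -/
def raise (j : ℕ) : (Finset ℕ → ℂ) →ₗ[ℂ] (Finset ℕ → ℂ) where
  toFun f z := ∑ x ∈ range j ∩ z, f (z.erase x)
  map_add' f g := by ext z; simp [sum_add_distrib]
  map_smul' c f := by ext z; simp [mul_sum]

/-- The lowering operator of the first `j` elements. -/
def lower (j : ℕ) : (Finset ℕ → ℂ) →ₗ[ℂ] (Finset ℕ → ℂ) where
  toFun f z := ∑ x ∈ range j \ z, f (insert x z)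
  map_add' f g := by ext z; simp [sum_add_distrib]
  map_smul' c f := by ext z; simp [mul_sum]

/-- Adjoin the set `w` to the argument: `attach w δ_z = δ_{z ∪ w}` for `z` disjoint from `w`. -/
def attach (w : Finset ℕ) : (Finset ℕ → ℂ) →ₗ[ℂ] (Finset ℕ → ℂ) where
  toFun f z := if w ⊆ z then f (z \ w) else 0
  map_add' f g := by ext z; by_cases h : w ⊆ z <;> simp [h]
  map_smul' c f := by ext z; by_cases h : w ⊆ z <;> simp [h]

/-- The action of permutations. -/
def relabel (σ : Perm ℕ) : (Finset ℕ → ℂ) →ₗ[ℂ] (Finset ℕ → ℂ) where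
  toFun f z := f (σ⁻¹ • z)
  map_add' f g := by ext z; simp
  map_smul' c f := by ext z; simp

/-- The sum of `(x y)` over all ordered pairs, including `x = y`, of the first `j` elements. -/
def transSum (j : ℕ) : (Finset ℕ → ℂ) →ₗ[ℂ] (Finset ℕ → ℂ) :=
  ∑ x ∈ range j, ∑ y ∈ range j, relabel (swap x y)

theorem raise_apply (j : ℕ) (f : Finset ℕ → ℂ) (z : Finset ℕ) :
    raise j f z = ∑ x ∈ range j ∩ z, f (z.erase x) := rfl

theorem lower_apply (j : ℕ) (f : Finset ℕ → ℂ) (z : Finset ℕ) :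
    lower j f z = ∑ x ∈ range j \ z, f (insert x z) := rfl

theorem attach_apply (w : Finset ℕ) (f : Finset ℕ → ℂ) (z : Finset ℕ) :
    attach w f z = if w ⊆ z then f (z \ w) else 0 := rfl

theorem relabel_apply (σ : Perm ℕ) (f : Finset ℕ → ℂ) (z : Finset ℕ) :
    relabel σ f z = f (σ⁻¹ • z) := rfl

theorem transSum_apply (j : ℕ) (f : Finset ℕ → ℂ) :
    transSum j f = ∑ x ∈ range j, ∑ y ∈ range j, relabel (swap x y) f := by
  simp [transSum, LinearMap.sum_apply]

/-- `f` lives on the sets with exactly `a` of the first `j` elements. -/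
def HasWeight (j a : ℕ) (f : Finset ℕ → ℂ) : Prop :=
  ∀ z, f z ≠ 0 → #(range j ∩ z) = a

/-- The `sl_2` commutation relation. Either order gives moves of one element out of `z` and another
into it, which agree, and a multiple of `f z`: once for each element outside `z` in one order, once
for each element inside in the other. -/
theorem lower_raise (j : ℕ) (f : Finset ℕ → ℂ) (z : Finset ℕ) :
    lower j (raise j f) z = raise j (lower j f) z + ((j : ℂ) - 2 * #(range j ∩ z)) * f z := by
  have h1 : ∀ x ∈ range j \ z, raise j f (insert x z) =
      f z + ∑ y ∈ range j ∩ z, f ((insert x z).erase y) := by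
    intro x hx
    rw [mem_sdiff] at hx
    rw [raise_apply, inter_insert_of_mem hx.1, sum_insert (by simp [hx.2]), erase_insert hx.2]
  have h2 : ∀ y ∈ range j ∩ z, lower j f (z.erase y) =
      f z + ∑ x ∈ range j \ z, f (insert x (z.erase y)) := by
    intro y hy
    rw [mem_inter] at hy
    rw [lower_apply, sdiff_erase hy.1, sum_insert (by simp [hy.2]), insert_erase hy.2]
  have h3 : (#(range j \ z) : ℂ) = j - #(range j ∩ z) := by
    have := card_sdiff_add_card_inter (range j) z
    rw [card_range] at this
    rw [eq_sub_iff_add_eq]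
    exact_mod_cast this
  rw [lower_apply, sum_congr rfl h1, raise_apply, sum_congr rfl h2, sum_add_distrib,
    sum_add_distrib, sum_comm, sum_const, sum_const, nsmul_eq_mul, nsmul_eq_mul, h3]
  have h4 : ∑ y ∈ range j ∩ z, ∑ x ∈ range j \ z, f ((insert x z).erase y) =
      ∑ y ∈ range j ∩ z, ∑ x ∈ range j \ z, f (insert x (z.erase y)) := by
    refine sum_congr rfl fun y hy => sum_congr rfl fun x hx => ?_
    rw [erase_insert_of_ne]
    rintro rfl
    simp at hx hy
    exact hx.2 hy.2
  rw [h4]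
  ring

theorem HasWeight.raise {j a : ℕ} {f : Finset ℕ → ℂ} (h : HasWeight j a f) :
    HasWeight j (a + 1) (raise j f) := by
  intro z hz
  obtain ⟨x, hx, hx'⟩ := exists_ne_zero_of_sum_ne_zero (raise_apply j f z ▸ hz)
  rw [← h _ hx', inter_erase, card_erase_add_one hx]

theorem HasWeight.raise_pow {j a : ℕ} {f : Finset ℕ → ℂ} (h : HasWeight j a f) (m : ℕ) :
    HasWeight j (a + m) ((JohnsonFFT.raise j ^ m) f) := by
  induction m with
  | zero => simpa using h
  | succ m ih => rw [pow_succ', Module.End.mul_apply]; exact ih.raise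

theorem lower_raise_of_hasWeight {j a : ℕ} {f : Finset ℕ → ℂ} (h : HasWeight j a f) :
    lower j (raise j f) = raise j (lower j f) + ((j : ℂ) - 2 * a) • f := by
  ext z
  rw [lower_raise, Pi.add_apply, Pi.smul_apply, smul_eq_mul]
  by_cases hz : f z = 0
  · simp [hz]
  · rw [h z hz]

/-- The scalar is the sum of the weights `j - 2 * (a + t)` over `t = 0, ..., m`, one commutator for
each raising. -/
theorem lower_raise_pow {j a : ℕ} {f : Finset ℕ → ℂ} (h : HasWeight j a f)
    (h0 : lower j f = 0) (m : ℕ) :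
    lower j ((raise j ^ (m + 1)) f) =
      (((m : ℂ) + 1) * ((j : ℂ) - 2 * a - m)) • (raise j ^ m) f := by
  induction m with
  | zero => simp [lower_raise_of_hasWeight h, h0]
  | succ m ih =>
    rw [pow_succ', Module.End.mul_apply, lower_raise_of_hasWeight (h.raise_pow (m + 1)), ih,
      map_smul, ← Module.End.mul_apply, ← pow_succ', ← add_smul]
    congr 1
    push_cast
    ring

/-- The powers of the raising operator are injective on the kernel of the lowering operator, as
long as the weights do not exceed the middle symmetrically. -/
theorem eq_zero_of_raise_pow_eq_zero {j a m : ℕ} {f : Finset ℕ → ℂ} (h : HasWeight j a f)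
    (h0 : lower j f = 0) (hm : 2 * a + m ≤ j) (hf : (raise j ^ m) f = 0) : f = 0 := by
  induction m with
  | zero => simpa using hf
  | succ m ih =>
    refine ih (by omega) ?_
    have h1 := lower_raise_pow h h0 m
    rw [hf, map_zero] at h1
    -- The factor `j - 2 * a - m` is at least `1` by `hm`, so lowering undoes the last raising up to
    -- a nonzero scalar.
    refine (smul_eq_zero.1 h1.symm).resolve_left (mul_ne_zero (by exact_mod_cast m.succ_ne_zero) ?_)
    obtain ⟨d, rfl⟩ := Nat.exists_eq_add_of_le hm
    have : ((2 * a + (m + 1) + d : ℕ) : ℂ) - 2 * a - m = ((d + 1 : ℕ) : ℂ) := by push_cast; ring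
    rw [this]
    exact_mod_cast d.succ_ne_zero

/-! ### Permutations -/

theorem relabel_raise {j : ℕ} {σ : Perm ℕ} (h : σ • range j = range j) (f : Finset ℕ → ℂ) :
    relabel σ (raise j f) = raise j (relabel σ f) := by
  ext z
  rw [relabel_apply, raise_apply, raise_apply]
  refine sum_bij (fun x _ => σ x) ?_ ?_ ?_ ?_
  · intro x hx
    rw [mem_inter] at hx ⊢
    refine ⟨?_, ?_⟩
    · rw [← h]; exact smul_mem_smul_finset hx.1
    · exact mem_inv_smul_finset_iff.1 hx.2
  · intro x _ y _ hxy; exact σ.injective hxy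
  · intro y hy
    rw [mem_inter] at hy
    refine ⟨σ⁻¹ y, ?_, by simp⟩
    rw [mem_inter]
    refine ⟨?_, smul_mem_smul_finset hy.2⟩
    have := hy.1
    rw [← h] at this
    exact (mem_inv_smul_finset_iff (a := σ⁻¹)).1 (by simpa using this)
  · intro x _
    rw [relabel_apply]
    congr 1
    ext y
    simp [mem_inv_smul_finset_iff]

theorem relabel_raise_pow {j : ℕ} {σ : Perm ℕ} (h : σ • range j = range j) (m : ℕ)
    (f : Finset ℕ → ℂ) : relabel σ ((raise j ^ m) f) = (raise j ^ m) (relabel σ f) := by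
  induction m with
  | zero => rfl
  | succ m ih =>
    rw [pow_succ', Module.End.mul_apply, relabel_raise h, ih, Module.End.mul_apply]

theorem relabel_attach {w : Finset ℕ} {σ : Perm ℕ} (h : σ • w = w) (f : Finset ℕ → ℂ) :
    relabel σ (attach w f) = attach w (relabel σ f) := by
  ext z
  have h1 : w ⊆ σ⁻¹ • z ↔ w ⊆ z := by rw [← smul_finset_subset_iff, h]
  rw [relabel_apply, attach_apply, attach_apply, relabel_apply, smul_finset_sdiff,
    inv_smul_eq_iff.2 h.symm]
  simp only [h1]

theorem mem_swap_smul {α : Type*} [DecidableEq α] {x y u : α} {s : Finset α} :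
    u ∈ swap x y • s ↔ swap x y u ∈ s := by
  rw [← swap_inv, mem_inv_smul_finset_iff, swap_inv, Perm.smul_def]

theorem swap_smul_of_mem_iff {α : Type*} [DecidableEq α] {x y : α} {s : Finset α}
    (h : x ∈ s ↔ y ∈ s) : swap x y • s = s := by
  ext u
  rw [mem_swap_smul]
  by_cases h1 : u = x
  · subst h1; simp [h]
  · by_cases h2 : u = y
    · subst h2; simp [h]
    · rw [swap_apply_of_ne_of_ne h1 h2]

theorem swap_smul_of_mem_of_notMem {α : Type*} [DecidableEq α] {x y : α} {s : Finset α}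
    (hx : x ∈ s) (hy : y ∉ s) : swap x y • s = insert y (s.erase x) := by
  ext u
  rw [mem_swap_smul]
  by_cases h1 : u = x
  · subst h1; simp [hy]; rintro rfl; contradiction
  · by_cases h2 : u = y
    · subst h2; simp [hx]
    · simp [swap_apply_of_ne_of_ne h1 h2, h1, h2]

theorem swap_smul_range {x y j : ℕ} (hx : x < j) (hy : y < j) :
    swap x y • range j = range j :=
  swap_smul_of_mem_iff (by simp [hx, hy])

theorem transSum_raise {i j : ℕ} (h : j ≤ i) (f : Finset ℕ → ℂ) :
    transSum j (raise i f) = raise i (transSum j f) := by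
  simp only [transSum_apply, map_sum]
  refine sum_congr rfl fun x hx => sum_congr rfl fun y hy => ?_
  rw [mem_range] at hx hy
  exact relabel_raise (swap_smul_range (hx.trans_le h) (hy.trans_le h)) f

theorem transSum_raise_pow {i j : ℕ} (h : j ≤ i) (m : ℕ) (f : Finset ℕ → ℂ) :
    transSum j ((raise i ^ m) f) = (raise i ^ m) (transSum j f) := by
  induction m with
  | zero => simp
  | succ m ih =>
    rw [pow_succ', Module.End.mul_apply, transSum_raise h, ih, Module.End.mul_apply]

theorem transSum_attach {j : ℕ} {w : Finset ℕ} (h : ∀ x ∈ w, j ≤ x) (f : Finset ℕ → ℂ) :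
    transSum j (attach w f) = attach w (transSum j f) := by
  simp only [transSum_apply, map_sum]
  refine sum_congr rfl fun x hx => sum_congr rfl fun y hy => ?_
  rw [mem_range] at hx hy
  refine relabel_attach (swap_smul_of_mem_iff (iff_of_false ?_ ?_)) f
  · exact fun hw => (h x hw).not_gt hx
  · exact fun hw => (h y hw).not_gt hy

theorem lower_attach {j : ℕ} {w : Finset ℕ} (h : ∀ x ∈ w, j ≤ x) (f : Finset ℕ → ℂ) :
    lower j (attach w f) = attach w (lower j f) := by
  ext z
  rw [lower_apply, attach_apply]
  have hd : ∀ x ∈ range j \ z, x ∉ w := fun x hx hw => by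
    have := h x hw
    simp at hx
    omega
  split_ifs with hw
  · rw [lower_apply]
    have h1 : range j \ (z \ w) = range j \ z := by
      ext x
      simp only [mem_sdiff, mem_range, not_and, not_not]
      refine and_congr_right fun hx => ⟨fun h' hz => ?_, fun h' hz => absurd hz h'⟩
      exact (h x (h' hz)).not_gt hx
    rw [h1]
    refine sum_congr rfl fun x hx => ?_
    rw [attach_apply, if_pos (hw.trans (subset_insert _ _)), insert_sdiff_of_notMem _ (hd x hx)]
  · refine sum_eq_zero fun x hx => ?_
    rw [attach_apply, if_neg]
    rwa [subset_insert_iff_of_notMem (hd x hx)]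

/-- The eigenvalue of the sum of transpositions on the irreducible representation of shape
`(j - a, a)`. -/
def eigval (j a : ℕ) : ℝ := (a : ℝ) ^ 2 + ((j : ℝ) - a) ^ 2 - 2 * a

/-- The difference of the two values factors as `2 * (b - a) * (j - a - b + 1)`, and `a + b ≤ j`
makes the last factor positive. -/
theorem eigval_injOn {j a b : ℕ} (ha : 2 * a ≤ j) (hb : 2 * b ≤ j)
    (h : eigval j a = eigval j b) : a = b := by
  have h1 : ((b : ℝ) - a) * (2 * (j - a - b + 1)) = 0 := by
    unfold eigval at h
    linear_combination h
  have h2 : (0 : ℝ) < j - a - b + 1 := by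
    have : ((a + b : ℕ) : ℝ) ≤ j := by exact_mod_cast (by omega : a + b ≤ j)
    push_cast at this
    linarith
  have h3 : (b : ℝ) - a = 0 := (mul_eq_zero.1 h1).resolve_right (by positivity)
  exact_mod_cast (sub_eq_zero.1 h3).symm

/-- At a set `z` of weight `a`, the `a ^ 2 + (j - a) ^ 2` pairs on one side of `z` fix `z`. For each
`x` in `z`, the swaps with the elements outside add up to `- f z`, which is `lower j f = 0` read at
`z.erase x`; each such pair occurs in both orders, whence `- 2 * a`. -/
theorem transSum_eq_smul {j a : ℕ} {f : Finset ℕ → ℂ} (h : HasWeight j a f)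
    (h0 : lower j f = 0) : transSum j f = (eigval j a : ℂ) • f := by
  ext z
  have h1 : transSum j f z = ∑ x ∈ range j, ∑ y ∈ range j, f (swap x y • z) := by
    simp [transSum_apply, Finset.sum_apply, relabel_apply, swap_inv]
  rw [h1, Pi.smul_apply, smul_eq_mul]
  by_cases hz : #(range j ∩ z) = a
  · have hc : (#(range j \ z) : ℂ) = j - a := by
      have := card_sdiff_add_card_inter (range j) z
      rw [card_range, hz] at this
      rw [eq_sub_iff_add_eq]
      exact_mod_cast this
    have key : ∀ x ∈ range j ∩ z, ∑ y ∈ range j \ z, f (swap x y • z) = - f z := by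
      intro x hx
      rw [mem_inter] at hx
      have := congrFun h0 (z.erase x)
      rw [lower_apply, sdiff_erase hx.1, sum_insert (by simp [hx.2]), insert_erase hx.2,
        Pi.zero_apply] at this
      rw [eq_neg_iff_add_eq_zero, add_comm, ← this]
      congr 1
      refine sum_congr rfl fun y hy => ?_
      rw [swap_smul_of_mem_of_notMem hx.2 (mem_sdiff.1 hy).2]
    have split : ∀ g : ℕ → ℂ, ∑ x ∈ range j, g x =
        ∑ x ∈ range j ∩ z, g x + ∑ x ∈ range j \ z, g x :=
      fun g => (sum_inter_add_sum_sdiff _ _ _).symm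
    have e1 : ∀ x ∈ range j ∩ z, ∑ y ∈ range j, f (swap x y • z) = (a - 1) * f z := by
      intro x hx
      rw [split, key x hx, sum_congr rfl (g := fun _ => f z), sum_const, hz, nsmul_eq_mul]
      · ring
      · intro y hy
        rw [swap_smul_of_mem_iff]
        simp_all
    have e2 : ∑ x ∈ range j \ z, ∑ y ∈ range j, f (swap x y • z) =
        ((j - a) ^ 2 - a) * f z := by
      have : ∀ x ∈ range j \ z, ∑ y ∈ range j, f (swap x y • z) =
          ∑ y ∈ range j ∩ z, f (swap y x • z) + (j - a) * f z := by
        intro x hx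
        rw [split]
        congr 1
        · exact sum_congr rfl fun y _ => by rw [swap_comm]
        · rw [sum_congr rfl (g := fun _ => f z), sum_const, nsmul_eq_mul, hc]
          intro y hy
          rw [swap_smul_of_mem_iff]
          simp_all
      rw [sum_congr rfl this, sum_add_distrib, sum_comm, sum_congr rfl key, sum_const, sum_const,
        nsmul_eq_mul, nsmul_eq_mul, hz, hc]
      ring
    rw [split, sum_congr rfl e1, e2, sum_const, hz, nsmul_eq_mul, eigval]
    push_cast
    ring
  -- Swaps of the first `j` elements preserve the weight, so off the weight `a` both sides vanish.
  · have h2 : f z = 0 := by by_contra h'; exact hz (h z h')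
    rw [h2, mul_zero]
    refine sum_eq_zero fun x hx => sum_eq_zero fun y hy => ?_
    by_contra h'
    apply hz
    rw [mem_range] at hx hy
    rw [← h _ h', ← card_smul_finset (swap x y), smul_finset_inter, swap_smul_range hx hy]

/-! ### Gelfand-Tsetlin vectors -/

/-- The Gelfand-Tsetlin vector, in the kernel of the lowering operator, of the standard tableau
with `i` boxes whose second row is `range i ∩ t`. -/
def gtVec (t : Finset ℕ) : ℕ → Finset ℕ → ℂ
  | 0 => Pi.single ∅ 1
  | i + 1 => if i ∈ t then
      raise i (gtVec t i) - ((i : ℂ) - 2 * #(range i ∩ t)) • attach {i} (gtVec t i)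
    else gtVec t i

theorem range_succ_inter_of_mem {t : Finset ℕ} {i : ℕ} (h : i ∈ t) :
    #(range (i + 1) ∩ t) = #(range i ∩ t) + 1 := by
  rw [range_add_one, insert_inter_of_mem h, card_insert_of_notMem (by simp)]

theorem range_succ_inter_of_notMem {t : Finset ℕ} {i : ℕ} (h : i ∉ t) :
    range (i + 1) ∩ t = range i ∩ t := by
  rw [range_add_one, insert_inter_of_notMem h]

theorem gtVec_support (t : Finset ℕ) (i : ℕ) {z : Finset ℕ} (hz : gtVec t i z ≠ 0) :
    z ⊆ range i ∧ #z = #(range i ∩ t) := by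
  induction i generalizing z with
  | zero =>
    have : z = ∅ := by
      by_contra h
      exact hz (Pi.single_eq_of_ne h _)
    simp [this]
  | succ i ih =>
    rw [gtVec] at hz
    split_ifs at hz with hi
    · rw [range_succ_inter_of_mem hi, range_add_one]
      rw [Pi.sub_apply, Pi.smul_apply, attach_apply, raise_apply] at hz
      by_cases h1 : ∑ x ∈ range i ∩ z, gtVec t i (z.erase x) = 0
      · rw [h1, zero_sub, neg_ne_zero] at hz
        split_ifs at hz with h2
        · rw [singleton_subset_iff] at h2
          obtain ⟨h3, h4⟩ := ih (right_ne_zero_of_mul hz)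
          rw [sdiff_singleton_eq_erase] at h3 h4
          refine ⟨subset_insert_iff.2 h3, ?_⟩
          rw [← h4, card_erase_add_one h2]
        · simp at hz
      · obtain ⟨x, hx, hx'⟩ := exists_ne_zero_of_sum_ne_zero h1
        obtain ⟨h3, h4⟩ := ih hx'
        rw [mem_inter] at hx
        refine ⟨fun y hy => mem_insert_of_mem ?_, ?_⟩
        · by_cases hxy : y = x
          · exact hxy ▸ hx.1
          · exact h3 (mem_erase.2 ⟨hxy, hy⟩)
        · rw [← h4, card_erase_add_one hx.2]
    · rw [range_succ_inter_of_notMem hi]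
      exact ⟨(ih hz).1.trans (range_subset_range.2 i.le_succ), (ih hz).2⟩

theorem gtVec_hasWeight (t : Finset ℕ) (i : ℕ) : HasWeight i #(range i ∩ t) (gtVec t i) := by
  intro z hz
  obtain ⟨h1, h2⟩ := gtVec_support t i hz
  rw [inter_eq_right.2 h1, h2]

theorem gtVec_eq_zero {t : Finset ℕ} {i x : ℕ} {z : Finset ℕ} (hx : x ∈ z) (hi : i ≤ x) :
    gtVec t i z = 0 := by
  by_contra h
  have := (gtVec_support t i h).1 hx
  rw [mem_range] at this
  omega

theorem raise_gtVec_insert (t : Finset ℕ) (i : ℕ) (z : Finset ℕ) :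
    raise i (gtVec t i) (insert i z) = 0 := by
  rw [raise_apply]
  refine sum_eq_zero fun x hx => gtVec_eq_zero (x := i) ?_ le_rfl
  simp only [mem_inter, mem_range] at hx
  exact mem_erase.2 ⟨by omega, mem_insert_self _ _⟩

theorem lower_succ (i : ℕ) (f : Finset ℕ → ℂ) (z : Finset ℕ) :
    lower (i + 1) f z = lower i f z + if i ∈ z then 0 else f (insert i z) := by
  rw [lower_apply, lower_apply, range_add_one]
  split_ifs with h
  · rw [insert_sdiff_of_mem _ h, add_zero]
  · rw [insert_sdiff_of_notMem _ h, sum_insert (by simp), add_comm]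

theorem attach_singleton_insert {i : ℕ} {z : Finset ℕ} (h : i ∉ z) (f : Finset ℕ → ℂ) :
    attach {i} f (insert i z) = f z := by
  rw [attach_apply, if_pos (by simp), sdiff_singleton_eq_erase, erase_insert h]

/-- This dictates the coefficient in `gtVec`: with `v` killed by `lower i`, lowering `raise i v`
gives `(i - 2 * a) • v`, and removing the new element `i` from the attached term gives the same with
the opposite sign. -/
theorem lower_gtVec (t : Finset ℕ) (i : ℕ) : lower i (gtVec t i) = 0 := by
  induction i with
  | zero => ext z; simp [lower_apply]
  | succ i ih =>
    ext z
    rw [lower_succ, gtVec]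
    split_ifs with h1 h2 h2
    · rw [map_sub, lower_raise_of_hasWeight (gtVec_hasWeight t i), ih, map_smul,
        lower_attach (by simp), ih]
      simp [gtVec_eq_zero h2]
    · rw [map_sub, lower_raise_of_hasWeight (gtVec_hasWeight t i), ih, map_smul,
        lower_attach (by simp), ih]
      simp [raise_gtVec_insert, attach_singleton_insert h2]
    · simp [ih]
    · rw [ih, gtVec_eq_zero (mem_insert_self i z) le_rfl]
      simp

/-- On sets containing the new element only the attached term contributes. Its coefficient `i - 2 *
a` is nonzero precisely because a box can be added to the second row only if `2 * a < i`. -/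
theorem gtVec_ne_zero {t : Finset ℕ} {i : ℕ} (ht : ∀ j ≤ i, 2 * #(range j ∩ t) ≤ j) :
    gtVec t i ≠ 0 := by
  induction i with
  | zero =>
    intro h
    have := congrFun h ∅
    simp [gtVec] at this
  | succ i ih =>
    obtain ⟨z, hz⟩ := Function.ne_iff.1 (ih fun j hj => ht j (hj.trans i.le_succ))
    rw [gtVec]
    split_ifs with h1
    · intro h
      have h2 : i ∉ z := fun h' => hz (gtVec_eq_zero h' le_rfl)
      have h3 := congrFun h (insert i z)
      rw [Pi.sub_apply, raise_gtVec_insert, Pi.smul_apply, attach_singleton_insert h2, zero_sub,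
        Pi.zero_apply, neg_eq_zero, smul_eq_zero] at h3
      refine hz (h3.resolve_left ?_)
      have h4 := ht (i + 1) le_rfl
      rw [range_succ_inter_of_mem h1] at h4
      have h5 : 2 * #(range i ∩ t) < i := by omega
      refine sub_ne_zero.2 ?_
      exact_mod_cast h5.ne'
    · exact ih fun j hj => ht j (hj.trans i.le_succ)

/-- The steps of the recursion after level `j` commute with the permutations of the first `j`
elements, so the eigenvalue found at level `j` persists. -/
theorem transSum_gtVec (t : Finset ℕ) {i j : ℕ} (h : j ≤ i) :
    transSum j (gtVec t i) = (eigval j #(range j ∩ t) : ℂ) • gtVec t i := by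
  induction i, h using Nat.le_induction with
  | base => exact transSum_eq_smul (gtVec_hasWeight t j) (lower_gtVec t j)
  | succ i hi ih =>
    rw [gtVec]
    split_ifs
    · rw [map_sub, map_smul, transSum_raise hi, transSum_attach (by simpa using hi), ih, map_smul,
        map_smul, smul_sub, smul_comm]
    · exact ih

/-- The function `U ^ m v`, with the set `w` adjoined, for the Gelfand-Tsetlin vector `v`. -/
def gtFun (t w : Finset ℕ) (i m : ℕ) : Finset ℕ → ℂ :=
  attach w ((raise i ^ m) (gtVec t i))

theorem transSum_gtFun {t w : Finset ℕ} {i j : ℕ} (h : j ≤ i) (hw : ∀ x ∈ w, i ≤ x) (m : ℕ) :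
    transSum j (gtFun t w i m) = (eigval j #(range j ∩ t) : ℂ) • gtFun t w i m := by
  rw [gtFun, transSum_attach fun x hx => h.trans (hw x hx), transSum_raise_pow h,
    transSum_gtVec t h, map_smul, map_smul]

theorem raise_pow_support {i : ℕ} {f : Finset ℕ → ℂ} (hf : ∀ z, f z ≠ 0 → z ⊆ range i) (m : ℕ)
    {z : Finset ℕ} (hz : (raise i ^ m) f z ≠ 0) : z ⊆ range i := by
  induction m generalizing z with
  | zero => exact hf z hz
  | succ m ih =>
    rw [pow_succ', Module.End.mul_apply, raise_apply] at hz
    obtain ⟨x, hx, hx'⟩ := exists_ne_zero_of_sum_ne_zero hz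
    intro y hy
    by_cases hxy : y = x
    · exact hxy ▸ (mem_inter.1 hx).1
    · exact ih hx' (mem_erase.2 ⟨hxy, hy⟩)

/-- What is left of the argument of a nonzero value of `attach w (raise i ^ m f)`. -/
theorem attach_raise_pow_support {i a : ℕ} {f : Finset ℕ → ℂ} (hf : ∀ z, f z ≠ 0 → z ⊆ range i)
    (ha : HasWeight i a f) {w : Finset ℕ} (m : ℕ)
    {z : Finset ℕ} (hz : attach w ((raise i ^ m) f) z ≠ 0) :
    #z = a + m + #w ∧ ∀ y, i ≤ y → (y ∈ z ↔ y ∈ w) := by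
  rw [attach_apply] at hz
  split_ifs at hz with h
  · have h1 := raise_pow_support hf m hz
    have h2 := ha.raise_pow m _ hz
    rw [inter_eq_right.2 h1] at h2
    refine ⟨by rw [← h2, card_sdiff_add_card_eq_card h], fun y hy =>
      ⟨fun hyz => ?_, fun hyw => h hyw⟩⟩
    by_contra hyw
    have := h1 (mem_sdiff.2 ⟨hyz, hyw⟩)
    rw [mem_range] at this
    omega
  · exact absurd rfl hz

theorem attach_eq_zero {i : ℕ} {f : Finset ℕ → ℂ} (hf : ∀ z, f z ≠ 0 → z ⊆ range i)
    {w : Finset ℕ} (hw : ∀ x ∈ w, i ≤ x) (h : attach w f = 0) : f = 0 := by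
  ext z
  by_contra hz
  have h1 := congrFun h (z ∪ w)
  rw [attach_apply, if_pos subset_union_right, union_sdiff_cancel_right] at h1
  · exact hz h1
  · rw [disjoint_left]
    intro x hx hx'
    have := hf z hz hx
    rw [mem_range] at this
    exact (hw x hx').not_gt this

/-- Gives both the nonvanishing of the labelled vectors and the injectivity of the embeddings of
Specht modules into `𝓕`. -/
theorem eq_zero_of_attach_raise_pow_eq_zero {i a m : ℕ} {f : Finset ℕ → ℂ}
    (hf : ∀ z, f z ≠ 0 → z ⊆ range i) (ha : HasWeight i a f) (h0 : lower i f = 0)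
    (hm : 2 * a + m ≤ i) {w : Finset ℕ} (hw : ∀ x ∈ w, i ≤ x)
    (h : attach w ((raise i ^ m) f) = 0) : f = 0 :=
  eq_zero_of_raise_pow_eq_zero ha h0 hm
    (attach_eq_zero (fun _ hz => raise_pow_support hf m hz) hw h)

/-! ### Restriction to a slice and extension by zero -/

/-- A permutation of the first `m` elements as a permutation of `ℕ`. -/
def permNat {m : ℕ} (σ : Perm (Fin m)) : Perm ℕ := σ.viaEmbedding Fin.valEmbedding

theorem permNat_inv {m : ℕ} (σ : Perm (Fin m)) : permNat σ⁻¹ = (permNat σ)⁻¹ :=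
  map_inv (Perm.viaEmbeddingHom Fin.valEmbedding) σ

theorem permNat_val {m : ℕ} (σ : Perm (Fin m)) (x : Fin m) : permNat σ x = σ x :=
  σ.viaEmbedding_apply Fin.valEmbedding x

theorem permNat_of_le {m : ℕ} (σ : Perm (Fin m)) {x : ℕ} (hx : m ≤ x) : permNat σ x = x := by
  refine σ.viaEmbedding_apply_of_notMem Fin.valEmbedding x ?_
  rintro ⟨y, rfl⟩
  exact y.isLt.not_ge hx

theorem permNat_lt_iff {m : ℕ} (σ : Perm (Fin m)) {x : ℕ} : permNat σ x < m ↔ x < m := by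
  rcases lt_or_ge x m with h | h
  · have := permNat_val σ ⟨x, h⟩
    simp only at this
    rw [this]
    simp [h]
  · rw [permNat_of_le σ h]

theorem permNat_swap {m : ℕ} (x y : Fin m) : permNat (swap x y) = swap (x : ℕ) (y : ℕ) := by
  ext u
  rcases lt_or_ge u m with h | h
  · lift u to Fin m using h
    rw [permNat_val, Fin.val_injective.swap_apply]
  · rw [permNat_of_le _ h, swap_apply_of_ne_of_ne] <;> omega

theorem permNat_smul_range {m j : ℕ} (σ : Perm (Fin m)) (h : m ≤ j) :
    permNat σ • range j = range j := by
  ext x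
  rw [← inv_inv (permNat σ), mem_inv_smul_finset_iff, ← permNat_inv, Perm.smul_def, mem_range,
    mem_range]
  rcases lt_or_ge x m with hx | hx
  · have := (permNat_lt_iff σ⁻¹).2 hx
    omega
  · rw [permNat_of_le _ hx]

theorem permNat_smul_of_le {m : ℕ} (σ : Perm (Fin m)) {w : Finset ℕ} (h : ∀ x ∈ w, m ≤ x) :
    permNat σ • w = w := by
  ext x
  rw [mem_smul_finset]
  constructor
  · rintro ⟨y, hy, rfl⟩
    rwa [Perm.smul_def, permNat_of_le _ (h y hy)]
  · exact fun hx => ⟨x, hx, permNat_of_le _ (h x hx)⟩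

/-- The restriction to the `k`-subsets of the first `n` elements. -/
def restrict (n k : ℕ) : (Finset ℕ → ℂ) →ₗ[ℂ] FunSpace n k where
  toFun f := WithLp.toLp 2 fun x => f ((x : Finset (Fin n)).map Fin.valEmbedding)
  map_add' f g := by ext x; simp
  map_smul' c f := by ext x; simp

theorem restrict_apply {n k : ℕ} (f : Finset ℕ → ℂ) (x : KSet n k) :
    restrict n k f x = f ((x : Finset (Fin n)).map Fin.valEmbedding) := rfl

theorem permRep_apply {n k : ℕ} (σ : Perm (Fin n)) (f : FunSpace n k) (x : KSet n k) :
    permRep n k σ f x = f (σ⁻¹ • x) := rfl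

theorem permNat_viaEmbedding {n i : ℕ} (hi : i ≤ n) (σ : Perm (Fin i)) :
    permNat (σ.viaEmbedding (Fin.castLEEmb hi)) = permNat σ := by
  ext u
  rcases lt_or_ge u i with h | h
  · lift u to Fin i using h
    have := permNat_val (σ.viaEmbedding (Fin.castLEEmb hi)) (Fin.castLEEmb hi u)
    rw [Perm.viaEmbedding_apply] at this
    rw [permNat_val]
    exact this
  · rw [permNat_of_le σ h]
    rcases lt_or_ge u n with h' | h'
    · have := permNat_val (σ.viaEmbedding (Fin.castLEEmb hi)) ⟨u, h'⟩
      rw [Perm.viaEmbedding_apply_of_notMem] at this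
      · exact this
      · rintro ⟨y, hy⟩
        have := congrArg Fin.val hy
        simp at this
        omega
    · rw [permNat_of_le _ h']

theorem map_val_smul {n : ℕ} (σ : Perm (Fin n)) (z : Finset (Fin n)) :
    (σ • z).map Fin.valEmbedding = permNat σ • z.map Fin.valEmbedding := by
  ext u
  simp only [mem_map, mem_smul_finset, Perm.smul_def, Fin.valEmbedding_apply]
  constructor
  · rintro ⟨_, ⟨y, hy, rfl⟩, rfl⟩
    exact ⟨y, ⟨y, hy, rfl⟩, permNat_val σ y⟩
  · rintro ⟨_, ⟨y, hy, rfl⟩, rfl⟩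
    exact ⟨σ y, ⟨y, hy, rfl⟩, (permNat_val σ y).symm⟩

theorem stageRep_restrict {n k i : ℕ} (hi : i ≤ n) (σ : Perm (Fin i)) (f : Finset ℕ → ℂ) :
    stageRep n k i hi σ (restrict n k f) = restrict n k (relabel (permNat σ) f) := by
  ext x
  change permRep n k (σ.viaEmbedding (Fin.castLEEmb hi)) (restrict n k f) x = _
  rw [permRep_apply, restrict_apply, restrict_apply, Set.powersetCard.coe_smul, map_val_smul,
    permNat_inv, permNat_viaEmbedding, relabel_apply]

/-- The extension by zero to all subsets of the `m`-set. -/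
def zeroExtend {m a : ℕ} (h : FunSpace m a) (z : Finset (Fin m)) : ℂ :=
  if hz : #z = a then h ⟨z, Set.powersetCard.mem_iff.2 hz⟩ else 0

theorem zeroExtend_coe {m a : ℕ} (h : FunSpace m a) (x : KSet m a) :
    zeroExtend h (x : Finset (Fin m)) = h x := by
  rw [zeroExtend, dif_pos (Set.powersetCard.card_eq x)]

theorem zeroExtend_of_ne {m a : ℕ} (h : FunSpace m a) {z : Finset (Fin m)} (hz : #z ≠ a) :
    zeroExtend h z = 0 := dif_neg hz

theorem zeroExtend_permRep {m a : ℕ} (σ : Perm (Fin m)) (h : FunSpace m a) (z : Finset (Fin m)) :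
    zeroExtend (permRep m a σ h) z = zeroExtend h (σ⁻¹ • z) := by
  by_cases hz : #z = a
  · rw [zeroExtend, dif_pos hz, permRep_apply, zeroExtend, dif_pos (by rwa [card_smul_finset])]
    rfl
  · rw [zeroExtend_of_ne _ hz, zeroExtend_of_ne _ (by rwa [card_smul_finset])]

theorem zeroExtend_add {m a : ℕ} (h h' : FunSpace m a) (z : Finset (Fin m)) :
    zeroExtend (h + h') z = zeroExtend h z + zeroExtend h' z := by
  unfold zeroExtend; split_ifs <;> simp

theorem zeroExtend_smul {m a : ℕ} (c : ℂ) (h : FunSpace m a) (z : Finset (Fin m)) :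
    zeroExtend (c • h) z = c * zeroExtend h z := by
  unfold zeroExtend; split_ifs <;> simp

/-- The elements of `z` among the first `m`. -/
def toFin (m : ℕ) (z : Finset ℕ) : Finset (Fin m) := univ.filter fun x => (x : ℕ) ∈ z

theorem mem_toFin {m : ℕ} {z : Finset ℕ} {x : Fin m} : x ∈ toFin m z ↔ (x : ℕ) ∈ z := by
  simp [toFin]

theorem toFin_map {m : ℕ} (z : Finset (Fin m)) : toFin m (z.map Fin.valEmbedding) = z := by
  ext x; simp [mem_toFin, Fin.val_inj]

theorem map_toFin {m : ℕ} {z : Finset ℕ} (hz : z ⊆ range m) :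
    (toFin m z).map Fin.valEmbedding = z := by
  ext x
  simp only [mem_map, mem_toFin, Fin.valEmbedding_apply]
  constructor
  · rintro ⟨y, hy, rfl⟩; exact hy
  · exact fun hx => ⟨⟨x, mem_range.1 (hz hx)⟩, hx, rfl⟩

/-- The extension by zero to all finite sets of natural numbers. -/
def extend (m a : ℕ) : FunSpace m a →ₗ[ℂ] (Finset ℕ → ℂ) where
  toFun h z := if z ⊆ range m then zeroExtend h (toFin m z) else 0
  map_add' f g := by ext z; by_cases hz : z ⊆ range m <;> simp [hz, zeroExtend_add]
  map_smul' c f := by ext z; by_cases hz : z ⊆ range m <;> simp [hz, zeroExtend_smul]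

theorem extend_apply {m a : ℕ} (h : FunSpace m a) (z : Finset ℕ) :
    extend m a h z = if z ⊆ range m then zeroExtend h (toFin m z) else 0 := rfl

theorem extend_map {m a : ℕ} (h : FunSpace m a) (z : Finset (Fin m)) :
    extend m a h (z.map Fin.valEmbedding) = zeroExtend h z := by
  rw [extend_apply, if_pos, toFin_map]
  intro x
  simp only [mem_map, mem_range]
  rintro ⟨y, _, rfl⟩
  exact y.isLt

theorem restrict_extend {m a : ℕ} (h : FunSpace m a) : restrict m a (extend m a h) = h := by
  ext x
  rw [restrict_apply, extend_map, zeroExtend_coe]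

theorem extend_support {m a : ℕ} (h : FunSpace m a) (z : Finset ℕ) (hz : extend m a h z ≠ 0) :
    z ⊆ range m ∧ #z = a := by
  rw [extend_apply] at hz
  split_ifs at hz with h1
  · refine ⟨h1, ?_⟩
    by_contra h2
    refine hz (zeroExtend_of_ne _ ?_)
    rwa [← card_map Fin.valEmbedding, map_toFin h1]
  · exact absurd rfl hz

theorem extend_hasWeight {m a : ℕ} (h : FunSpace m a) : HasWeight m a (extend m a h) := by
  intro z hz
  obtain ⟨h1, h2⟩ := extend_support h z hz
  rw [inter_eq_right.2 h1, h2]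

theorem extend_restrict {m a : ℕ} {f : Finset ℕ → ℂ} (hf : ∀ z, f z ≠ 0 → z ⊆ range m ∧ #z = a) :
    extend m a (restrict m a f) = f := by
  ext z
  rw [extend_apply]
  split_ifs with h1
  · by_cases h2 : #z = a
    · rw [zeroExtend, dif_pos (by rw [← card_map Fin.valEmbedding, map_toFin h1, h2]),
        restrict_apply, map_toFin h1]
    · rw [zeroExtend_of_ne _ (by rwa [← card_map Fin.valEmbedding, map_toFin h1])]
      by_contra h
      exact h2 (hf z (Ne.symm h)).2
  · by_contra h
    exact h1 (hf z (Ne.symm h)).1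

theorem extend_permRep {m a : ℕ} (σ : Perm (Fin m)) (h : FunSpace m a) :
    extend m a (permRep m a σ h) = relabel (permNat σ) (extend m a h) := by
  ext z
  have h1 : (permNat σ)⁻¹ • z ⊆ range m ↔ z ⊆ range m := by
    rw [← smul_finset_subset_smul_finset_iff (a := permNat σ), smul_inv_smul,
      permNat_smul_range σ le_rfl]
  have h2 : toFin m ((permNat σ)⁻¹ • z) = σ⁻¹ • toFin m z := by
    ext x
    rw [mem_toFin, mem_inv_smul_finset_iff, mem_inv_smul_finset_iff, mem_toFin, Perm.smul_def,
      Perm.smul_def, permNat_val]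
  rw [relabel_apply, extend_apply, extend_apply, h2, zeroExtend_permRep]
  simp only [h1]

/-- `h` is in the kernel of the map that sums over the `a`-sets that contain an `a - 1`-set. -/
def IsHarmonic {m a : ℕ} (h : FunSpace m a) : Prop :=
  ∀ z : Finset (Fin m), ∑ y ∈ zᶜ, zeroExtend h (insert y z) = 0

theorem isHarmonic_iff {m a : ℕ} {h : FunSpace m a} :
    IsHarmonic h ↔ lower m (extend m a h) = 0 := by
  have key : ∀ z : Finset (Fin m), lower m (extend m a h) (z.map Fin.valEmbedding) =
      ∑ y ∈ zᶜ, zeroExtend h (insert y z) := by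
    intro z
    have h1 : range m \ z.map Fin.valEmbedding = zᶜ.map Fin.valEmbedding := by
      ext x
      simp only [mem_sdiff, mem_range, mem_map, mem_compl, Fin.valEmbedding_apply, not_exists,
        not_and]
      constructor
      · rintro ⟨hx, hx'⟩
        exact ⟨⟨x, hx⟩, fun hz => hx' _ hz rfl, rfl⟩
      · rintro ⟨y, hy, rfl⟩
        refine ⟨y.isLt, fun u hu huy => hy ?_⟩
        rwa [← Fin.ext huy]
    rw [lower_apply, h1, sum_map]
    refine sum_congr rfl fun y _ => ?_
    rw [← map_insert, extend_map]
  constructor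
  · intro hh
    ext z
    by_cases hz : z ⊆ range m
    · rw [← map_toFin hz, key, hh, Pi.zero_apply]
    · rw [lower_apply]
      refine sum_eq_zero fun x _ => ?_
      rw [extend_apply, if_neg fun h' => hz ((subset_insert x z).trans h')]
  · intro hh z
    rw [← key, hh, Pi.zero_apply]

theorem sum_zeroExtend_permRep {m a : ℕ} (h : FunSpace m a) (σ : Perm (Fin m))
    (z : Finset (Fin m)) :
    ∑ y ∈ zᶜ, zeroExtend (permRep m a σ h) (insert y z) =
      ∑ y ∈ (σ⁻¹ • z)ᶜ, zeroExtend h (insert y (σ⁻¹ • z)) := by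
  refine sum_bij (fun y _ => σ⁻¹ y) ?_ ?_ ?_ ?_
  · intro y hy
    rw [mem_compl] at hy ⊢
    rwa [← Perm.smul_def, smul_mem_smul_finset_iff]
  · intro x _ y _ hxy; exact (σ⁻¹).injective hxy
  · intro y hy
    refine ⟨σ y, ?_, by simp⟩
    rw [mem_compl] at hy ⊢
    rwa [mem_inv_smul_finset_iff] at hy
  · intro y _
    rw [zeroExtend_permRep, smul_finset_insert]
    rfl

theorem IsHarmonic.permRep {m a : ℕ} {h : FunSpace m a} (hh : IsHarmonic h) (σ : Perm (Fin m)) :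
    IsHarmonic (permRep m a σ h) := fun z => by
  rw [sum_zeroExtend_permRep, hh]

/-! ### The Specht module is the space of harmonic functions -/

/-! ### Columns of the tableau and the polytabloid -/

section Column

variable {m a : ℕ}

theorem column_partner (ha : 2 * a ≤ m) {x : Fin m} (hx : column m a x < a) :
    ∃ y, y ≠ x ∧ column m a y = column m a x := by
  unfold column at *
  split_ifs at hx with h
  · refine ⟨⟨m - a + x, by omega⟩, ?_, ?_⟩
    · rw [Ne, Fin.ext_iff]; simp only; omega
    · simp only; split_ifs <;> omega
  · refine ⟨⟨x - (m - a), by omega⟩, ?_, ?_⟩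
    · rw [Ne, Fin.ext_iff]; simp only; omega
    · simp only; split_ifs <;> omega

theorem column_lt (ha : 2 * a ≤ m) {x y : Fin m} (hxy : x ≠ y)
    (h : column m a x = column m a y) : column m a x < a := by
  have := x.isLt
  have := y.isLt
  rw [Ne, Fin.ext_iff] at hxy
  unfold column at *
  split_ifs at * <;> omega

theorem column_eq_or {x y u : Fin m} (hxy : x ≠ y)
    (h : column m a x = column m a y) (hu : column m a u = column m a x) : u = x ∨ u = y := by
  rw [Ne, Fin.ext_iff] at hxy
  rw [Fin.ext_iff, Fin.ext_iff]
  unfold column at *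
  split_ifs at * <;> omega

theorem exists_column_eq (ha : 2 * a ≤ m) {l : ℕ} (hl : l < a) :
    ∃ x : Fin m, column m a x = l :=
  ⟨⟨l, by omega⟩, by unfold column; simp only; split_ifs <;> omega⟩

theorem notMem_secondRow_of_mem {x y : Fin m} (hxy : x ≠ y)
    (h : column m a x = column m a y) (hx : x ∈ secondRow m a) : y ∉ secondRow m a := by
  rw [Ne, Fin.ext_iff] at hxy
  simp only [secondRow, mem_filter, mem_univ, true_and] at *
  unfold column at *
  split_ifs at * <;> omega

theorem column_lt_of_mem_secondRow (ha : 2 * a ≤ m) {x : Fin m} (hx : x ∈ secondRow m a) :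
    column m a x < a := by
  have := x.isLt
  simp only [secondRow, mem_filter, mem_univ, true_and] at hx
  unfold column
  split_ifs <;> omega

theorem card_secondRow (ha : 2 * a ≤ m) : #(secondRow m a) = a := by
  have h : #((secondRow m a).map Fin.valEmbedding) = #(Ico (m - a) m) := by
    congr 1
    ext x
    simp only [mem_map, secondRow, mem_filter, mem_univ, true_and, Fin.valEmbedding_apply, mem_Ico]
    constructor
    · rintro ⟨y, hy, rfl⟩; exact ⟨hy, y.isLt⟩
    · rintro ⟨h1, h2⟩; exact ⟨⟨x, h2⟩, h1, rfl⟩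
  rw [card_map, Nat.card_Ico] at h
  omega

theorem mem_columnGroup {π : Perm (Fin m)} :
    π ∈ columnGroup m a ↔ ∀ x, column m a (π x) = column m a x := by
  simp [columnGroup]

theorem swap_mem_columnGroup {x y : Fin m} (h : column m a x = column m a y) :
    swap x y ∈ columnGroup m a := by
  rw [mem_columnGroup]
  intro u
  by_cases h1 : u = x
  · rw [h1, swap_apply_left, h]
  · by_cases h2 : u = y
    · rw [h2, swap_apply_right, h]
    · rw [swap_apply_of_ne_of_ne h1 h2]

theorem polytabloid_apply (x : KSet m a) :
    polytabloid m a x = ∑ π ∈ columnGroup m a,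
      if (x : Finset (Fin m)) = π • secondRow m a then ((Perm.sign π : ℤ) : ℂ) else 0 := rfl

theorem permRep_swap_polytabloid {x y : Fin m} (hxy : x ≠ y)
    (h : column m a x = column m a y) :
    permRep m a (swap x y) (polytabloid m a) = - polytabloid m a := by
  ext u
  rw [permRep_apply, polytabloid_apply, PiLp.neg_apply, polytabloid_apply, ← sum_neg_distrib]
  have hs := mem_columnGroup.1 (swap_mem_columnGroup h)
  refine sum_bij (fun π _ => swap x y * π) ?_ ?_ ?_ ?_
  · intro π hπ
    rw [mem_columnGroup] at hπ ⊢
    intro z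
    rw [Perm.mul_apply, hs, hπ]
  · intro π _ π' _ h'; exact mul_left_cancel h'
  · intro π hπ
    refine ⟨swap x y * π, ?_, by rw [← mul_assoc, swap_mul_self, one_mul]⟩
    rw [mem_columnGroup] at hπ ⊢
    intro z
    rw [Perm.mul_apply, hs, hπ]
  · intro π _
    have h1 : ((swap x y)⁻¹ • u : KSet m a) = π • secondRow m a ↔
        (u : Finset (Fin m)) = (swap x y * π) • secondRow m a := by
      rw [Set.powersetCard.coe_smul, inv_smul_eq_iff, mul_smul]
    simp only [h1, Perm.sign_mul, Perm.sign_swap hxy]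
    split_ifs <;> simp

/-- An `a - 1`-set misses one of the `a` columns with two entries. Swapping these entries fixes the
set and negates the polytabloid, so the sum equals its own negative. -/
theorem polytabloid_isHarmonic (ha : 2 * a ≤ m) : IsHarmonic (polytabloid m a) := by
  intro z
  by_cases hz : #z + 1 = a
  · obtain ⟨l, hl, hl'⟩ : ∃ l ∈ range a, l ∉ z.image (column m a) := by
      by_contra! h
      have := card_le_card h
      have := card_image_le (s := z) (f := column m a)
      rw [card_range] at *
      omega
    obtain ⟨x, hx⟩ := exists_column_eq ha (mem_range.1 hl)
    obtain ⟨y, hyx, hy⟩ := column_partner ha (hx.trans_lt (mem_range.1 hl))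
    have h1 : x ∉ z := fun h => hl' (mem_image.2 ⟨x, h, hx⟩)
    have h2 : y ∉ z := fun h => hl' (mem_image.2 ⟨y, h, hy.trans hx⟩)
    have h3 := sum_zeroExtend_permRep (polytabloid m a) (swap x y) z
    rw [permRep_swap_polytabloid hyx.symm hy.symm, swap_inv,
      swap_smul_of_mem_iff (iff_of_false h1 h2), ← neg_one_smul ℂ] at h3
    simp only [zeroExtend_smul] at h3
    rw [← mul_sum, neg_one_mul] at h3
    exact neg_eq_self.1 h3
  · refine sum_eq_zero fun y hy => zeroExtend_of_ne _ ?_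
    rwa [card_insert_of_notMem (mem_compl.1 hy)]

end Column

/-- The harmonic functions as a subspace. -/
def harmonic (m a : ℕ) : Submodule ℂ (FunSpace m a) := LinearMap.ker (lower m ∘ₗ extend m a)

theorem mem_harmonic {m a : ℕ} {h : FunSpace m a} : h ∈ harmonic m a ↔ IsHarmonic h := by
  rw [isHarmonic_iff]; rfl

theorem specht_le_harmonic {m a : ℕ} (ha : 2 * a ≤ m) :
    (specht m a).toSubmodule ≤ harmonic m a := by
  refine Submodule.span_le.2 ?_
  rintro _ ⟨σ, rfl⟩
  exact mem_harmonic.2 ((polytabloid_isHarmonic ha).permRep σ)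

theorem inner_permRep {n k : ℕ} (σ : Perm (Fin n)) (f g : FunSpace n k) :
    inner ℂ (permRep n k σ f) (permRep n k σ g) = inner ℂ f g := by
  rw [PiLp.inner_apply, PiLp.inner_apply]
  exact Equiv.sum_comp (MulAction.toPerm σ⁻¹) fun x => inner ℂ (f x) (g x)

theorem permRep_mem_specht {m a : ℕ} (σ : Perm (Fin m)) {h : FunSpace m a}
    (hh : h ∈ (specht m a).toSubmodule) : permRep m a σ h ∈ (specht m a).toSubmodule :=
  (specht m a).apply_mem_toSubmodule σ hh

/-- The harmonic functions orthogonal to the Specht module. -/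
def defect (m a : ℕ) : Submodule ℂ (FunSpace m a) := harmonic m a ⊓ (specht m a).toSubmoduleᗮ

/-! ### Harmonic functions orthogonal to the Specht module vanish -/

section Defect

variable {m a : ℕ}

theorem permRep_mem_defect (σ : Perm (Fin m)) {f : FunSpace m a} (hf : f ∈ defect m a) :
    permRep m a σ f ∈ defect m a := by
  refine ⟨mem_harmonic.2 ((mem_harmonic.1 hf.1).permRep σ), ?_⟩
  rw [SetLike.mem_coe, Submodule.mem_orthogonal]
  intro u hu
  have := (Submodule.mem_orthogonal _ _).1 hf.2 _ (permRep_mem_specht σ⁻¹ hu)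
  rw [← this, ← inner_permRep σ⁻¹, ← Module.End.mul_apply, ← map_mul]
  simp

/-- `f` changes its sign under the transpositions of the two entries of any of the first `b`
columns. -/
def IsAnti (b : ℕ) (f : FunSpace m a) : Prop :=
  ∀ x y, x ≠ y → column m a x = column m a y → column m a x < b → permRep m a (swap x y) f = -f

theorem IsAnti.apply_swap {b : ℕ} {f : FunSpace m a} (hf : IsAnti b f) {x y : Fin m} (hxy : x ≠ y)
    (h : column m a x = column m a y) (hb : column m a x < b) (z : Finset (Fin m)) :
    zeroExtend f (swap x y • z) = - zeroExtend f z := by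
  have := zeroExtend_permRep (swap x y) f z
  rw [hf x y hxy h hb, swap_inv, ← neg_one_smul ℂ, zeroExtend_smul, neg_one_mul] at this
  exact this.symm

theorem IsAnti.eq_zero {b : ℕ} {f : FunSpace m a} (hf : IsAnti b f) {x y : Fin m} (hxy : x ≠ y)
    (h : column m a x = column m a y) (hb : column m a x < b) {z : Finset (Fin m)}
    (hz : x ∈ z ↔ y ∈ z) : zeroExtend f z = 0 := by
  have := hf.apply_swap hxy h hb z
  rw [swap_smul_of_mem_iff hz] at this
  exact self_eq_neg.1 this

theorem eq_zero_of_zeroExtend {f : FunSpace m a} (h : ∀ z, #z = a → zeroExtend f z = 0) : f = 0 := by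
  ext x
  rw [← zeroExtend_coe]
  exact h _ (Set.powersetCard.card_eq x)

/-- Swaps within columns generate the column stabilizer: composing `π` with `swap x (π x)` shrinks
its support. -/
theorem IsAnti.permRep_eq {f : FunSpace m a} (ha : 2 * a ≤ m) (hf : IsAnti a f)
    (π : Perm (Fin m)) (hπ : π ∈ columnGroup m a) :
    permRep m a π f = ((Perm.sign π : ℤ) : ℂ) • f := by
  induction hn : #π.support using Nat.strong_induction_on generalizing π with
  | _ n ih =>
  by_cases h1 : π = 1
  · simp [h1]
  · obtain ⟨x, hx⟩ : ∃ x, π x ≠ x := by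
      by_contra! h
      exact h1 (Equiv.ext h)
    have hc := mem_columnGroup.1 hπ
    have h2 : swap x (π x) * π ∈ columnGroup m a := by
      rw [mem_columnGroup]
      intro u
      rw [Perm.mul_apply, mem_columnGroup.1 (swap_mem_columnGroup (hc x).symm), hc]
    have h3 := ih _ (hn ▸ Perm.card_support_swap_mul hx) _ h2 rfl
    have h4 : π = swap x (π x) * (swap x (π x) * π) := by
      rw [← mul_assoc, swap_mul_self, one_mul]
    rw [h4, map_mul, Module.End.mul_apply, h3, map_smul,
      hf x (π x) hx.symm (hc x).symm (column_lt ha hx.symm (hc x).symm), ← h4]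
    simp [Perm.sign_swap hx.symm]

/-- The inner product with the polytabloid is a signed sum of values of `f`; antisymmetry makes
every term equal to the value at the second row, so orthogonality kills that value. -/
theorem IsAnti.zeroExtend_secondRow {f : FunSpace m a} (ha : 2 * a ≤ m) (hf : IsAnti a f)
    (hd : f ∈ defect m a) : zeroExtend f (secondRow m a) = 0 := by
  have h0 : inner ℂ (polytabloid m a) f = 0 := by
    refine (Submodule.mem_orthogonal _ _).1 hd.2 _ (Submodule.subset_span ⟨1, ?_⟩)
    simp
  have h1 : inner ℂ (polytabloid m a) f =
      ∑ π ∈ columnGroup m a, ((Perm.sign π : ℤ) : ℂ) * zeroExtend f (π • secondRow m a) := by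
    have h2 : ∀ x, inner ℂ (polytabloid m a x) (f x) = ∑ π ∈ columnGroup m a,
        if (x : Finset (Fin m)) = π • secondRow m a then
          ((Perm.sign π : ℤ) : ℂ) * zeroExtend f (π • secondRow m a) else 0 := by
      intro x
      rw [polytabloid_apply, RCLike.inner_apply, map_sum, mul_sum]
      refine sum_congr rfl fun π _ => ?_
      split_ifs with h
      · rw [← h, zeroExtend_coe, mul_comm]
        simp
      · simp
    rw [PiLp.inner_apply, sum_congr rfl fun x _ => h2 x, sum_comm]
    refine sum_congr rfl fun π _ => ?_
    rw [sum_eq_single (⟨π • secondRow m a, by simp [card_secondRow ha]⟩ : KSet m a)]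
    · simp
    · intro x _ hx
      rw [if_neg]
      exact fun h => hx (Subtype.ext h)
    · simp
  have h3 : ∀ π ∈ columnGroup m a, ((Perm.sign π : ℤ) : ℂ) * zeroExtend f (π • secondRow m a) =
      zeroExtend f (secondRow m a) := by
    intro π hπ
    have h4 := zeroExtend_permRep π f (π • secondRow m a)
    rw [hf.permRep_eq ha π hπ, inv_smul_smul, zeroExtend_smul] at h4
    exact h4
  rw [h1, sum_congr rfl h3, sum_const, nsmul_eq_mul, mul_eq_zero] at h0
  refine h0.resolve_left ?_
  have : (1 : Perm (Fin m)) ∈ columnGroup m a := mem_columnGroup.2 fun _ => rfl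
  exact_mod_cast (card_pos.2 ⟨_, this⟩).ne'

/-- Column swaps bring every set to the second row, up to sign, unless they meet a column with both
entries absent, where `f` vanishes anyway. The induction is on the number of second-row entries
missing from `z`. -/
theorem IsAnti.eq_zero_of_mem_defect {f : FunSpace m a} (ha : 2 * a ≤ m) (hf : IsAnti a f)
    (hd : f ∈ defect m a) : f = 0 := by
  refine eq_zero_of_zeroExtend fun z hz => ?_
  induction hn : #(secondRow m a \ z) generalizing z with
  | zero =>
    have : secondRow m a = z :=
      eq_of_subset_of_card_le (sdiff_eq_empty_iff_subset.1 (card_eq_zero.1 hn))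
        (by rw [hz, card_secondRow ha])
    rw [← this, hf.zeroExtend_secondRow ha hd]
  | succ n ih =>
    obtain ⟨r, hr⟩ := card_pos.1 (n.succ_pos.trans_eq hn.symm)
    have hr' := mem_sdiff.1 hr
    have hra := column_lt_of_mem_secondRow ha hr'.1
    obtain ⟨s, hsr, hs⟩ := column_partner ha hra
    by_cases hsz : s ∈ z
    · have h1 := hf.apply_swap hsr hs (hs ▸ hra) z
      rw [ih (swap s r • z) (by rw [card_smul_finset, hz])] at h1
      · exact neg_eq_zero.1 h1.symm
      · have h2 : secondRow m a \ (swap s r • z) = (secondRow m a \ z).erase r := by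
          have := notMem_secondRow_of_mem hsr.symm hs.symm hr'.1
          rw [swap_smul_of_mem_of_notMem hsz hr'.2]
          ext u
          simp only [mem_sdiff, mem_insert, mem_erase, not_or, not_and]
          constructor
          · rintro ⟨h1, h2, h3⟩
            exact ⟨h2, h1, h3 fun h => this (h ▸ h1)⟩
          · rintro ⟨h1, h2, h3⟩
            exact ⟨h2, h1, fun _ => h3⟩
        rw [h2, card_erase_of_mem hr, hn, Nat.add_sub_cancel]
    · exact hf.eq_zero hsr hs (hs ▸ hra) (iff_of_false hsz hr'.2)

/-- Only sets `z` with exactly one entry in each of the first `b` columns matter, and since `b < a`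
such a set has some `u` in a later column. In the harmonic relation at `z.erase u`, adding an entry
of a later column gives `f z` by symmetry, while adding one of the first `b` columns fills that
column and gives `0`. So a positive multiple of `f z` vanishes. -/
theorem eq_zero_of_isAnti_of_symmetric {b : ℕ} (ha : 2 * a ≤ m) (hb : b < a) {f : FunSpace m a}
    (hf : IsAnti b f) (hh : IsHarmonic f)
    (hs : ∀ x y, b ≤ column m a x → b ≤ column m a y → permRep m a (swap x y) f = f) : f = 0 := by
  refine eq_zero_of_zeroExtend fun z hz => ?_
  by_cases hA : ∃ x y, x ≠ y ∧ column m a x = column m a y ∧ column m a x < b ∧ (x ∈ z ↔ y ∈ z)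
  · obtain ⟨x, y, h1, h2, h3, h4⟩ := hA
    exact hf.eq_zero h1 h2 h3 h4
  · obtain ⟨u, hu, hub⟩ : ∃ u ∈ z, b ≤ column m a u := by
      by_contra! h
      have h1 : #(z.image (column m a)) ≤ b := by
        rw [← card_range b]
        refine card_le_card fun l hl => ?_
        obtain ⟨x, hx, rfl⟩ := mem_image.1 hl
        exact mem_range.2 (h x hx)
      rw [card_image_of_injOn, hz] at h1
      · omega
      · intro x hx y hy hxy
        by_contra hne
        exact hA ⟨x, y, hne, hxy, h x hx, iff_of_true hx hy⟩
    have h1 := hh (z.erase u)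
    have h2 : ∀ y ∈ (z.erase u)ᶜ, zeroExtend f (insert y (z.erase u)) =
        if b ≤ column m a y then zeroExtend f z else 0 := by
      intro y hy
      split_ifs with hyb
      · by_cases hyu : y = u
        · rw [hyu, insert_erase hu]
        · have hyz : y ∉ z := fun h => (mem_compl.1 hy) (mem_erase.2 ⟨hyu, h⟩)
          have := zeroExtend_permRep (swap u y) f z
          rw [hs u y hub hyb, swap_inv, swap_smul_of_mem_of_notMem hu hyz] at this
          exact this.symm
      · rw [not_le] at hyb
        have hyu : y ≠ u := by rintro rfl; omega
        have hyz : y ∉ z := fun h => (mem_compl.1 hy) (mem_erase.2 ⟨hyu, h⟩)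
        obtain ⟨v, hvy, hv⟩ := column_partner ha (hyb.trans hb)
        have hvz : v ∈ z := by
          by_contra h
          exact hA ⟨v, y, hvy, hv, hv ▸ hyb, iff_of_false h hyz⟩
        have hvu : v ≠ u := by rintro rfl; omega
        exact hf.eq_zero hvy hv (hv ▸ hyb)
          (iff_of_true (mem_insert_of_mem (mem_erase.2 ⟨hvu, hvz⟩)) (mem_insert_self _ _))
    rw [sum_congr rfl h2, ← sum_filter, sum_const, nsmul_eq_mul, mul_eq_zero] at h1
    refine h1.resolve_left ?_
    have : u ∈ (z.erase u)ᶜ.filter fun y => b ≤ column m a y := by simp [hub]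
    exact_mod_cast (card_pos.2 ⟨_, this⟩).ne'

/-- Used to carry two entries into a chosen column; moving at most these four points leaves the
earlier columns in place. -/
theorem exists_perm_moving {α : Type*} [DecidableEq α] {x y u v : α} (hxy : x ≠ y) (huv : u ≠ v) :
    ∃ ρ : Perm α, ρ x = u ∧ ρ y = v ∧
      ∀ w, w ≠ x → w ≠ y → w ≠ u → w ≠ v → ρ w = w := by
  have h1 : swap x u y ≠ u := by
    intro h
    apply hxy
    rw [← (swap x u).injective.eq_iff, h, swap_apply_left]
  refine ⟨swap (swap x u y) v * swap x u, ?_, ?_, ?_⟩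
  · rw [Perm.mul_apply, swap_apply_left, swap_apply_of_ne_of_ne h1.symm huv]
  · rw [Perm.mul_apply, swap_apply_left]
  · intro w h2 h3 h4 h5
    have h6 : swap x u w = w := swap_apply_of_ne_of_ne h2 h4
    rw [Perm.mul_apply, h6, swap_apply_of_ne_of_ne _ h5]
    intro h
    apply h3
    rw [← (swap x u).injective.eq_iff, h6, h]

theorem permRep_permRep (σ τ : Perm (Fin m)) (f : FunSpace m a) :
    permRep m a σ (permRep m a τ f) = permRep m a (σ * τ) f := by
  rw [map_mul, Module.End.mul_apply]

/-- Downward induction on `b`. For entries `x`, `y` outside the first `b` columns, `f` minus its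
image under the swap is antisymmetric in `x` and `y`; moved so that these occupy column `b`, it has
one more antisymmetric column and vanishes. Hence `f` is symmetric in all the remaining entries, and
`eq_zero_of_isAnti_of_symmetric` applies. -/
theorem eq_zero_of_isAnti_of_mem_defect (ha : 2 * a ≤ m) {b : ℕ} (hb : b ≤ a) {f : FunSpace m a}
    (hf : IsAnti b f) (hd : f ∈ defect m a) : f = 0 := by
  induction hn : a - b generalizing b f with
  | zero =>
    obtain rfl : b = a := by omega
    exact hf.eq_zero_of_mem_defect ha hd
  | succ n ih =>
    have hba : b < a := by omega
    refine eq_zero_of_isAnti_of_symmetric ha hba hf (mem_harmonic.1 hd.1) fun x y hx hy => ?_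
    by_cases hxy : x = y
    · rw [hxy, swap_self, ← Perm.one_def, map_one, Module.End.one_apply]
    obtain ⟨u, hu⟩ := exists_column_eq ha hba
    obtain ⟨v, hvu, hv⟩ := column_partner ha (hu.trans_lt hba)
    obtain ⟨ρ, hρx, hρy, hρ⟩ := exists_perm_moving hxy hvu.symm
    have hfix : ∀ w, column m a w < b → ρ w = w := by
      intro w hw
      apply hρ <;> rintro rfl <;> omega
    set g := f - permRep m a (swap x y) f with hg
    have hgd : permRep m a ρ g ∈ defect m a :=
      permRep_mem_defect ρ (sub_mem hd (permRep_mem_defect _ hd))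
    have hswap : ∀ p q, permRep m a (swap (ρ p) (ρ q)) (permRep m a ρ g) =
        permRep m a ρ (permRep m a (swap p q) g) := by
      intro p q
      rw [permRep_permRep, permRep_permRep, ← mul_swap_eq_swap_mul]
    -- In the first `b` columns `ρ` is the identity and the swaps commute with `swap x y`; in column
    -- `b` the swap is the conjugate of `swap x y` by `ρ`, which negates `g`.
    have hga : IsAnti (b + 1) (permRep m a ρ g) := by
      intro p q hpq hc hcb
      rcases Nat.lt_succ_iff_lt_or_eq.1 hcb with hlt | heq
      · have := hswap p q
        rw [hfix p hlt, hfix q (hc ▸ hlt)] at this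
        have hcomm : swap p q * swap x y = swap x y * swap p q := by
          rw [mul_swap_eq_swap_mul, swap_apply_of_ne_of_ne, swap_apply_of_ne_of_ne] <;>
            (rintro rfl; omega)
        rw [this, hg, map_sub, permRep_permRep, hcomm, ← permRep_permRep, hf p q hpq hc hlt,
          map_neg (permRep m a (swap x y)), ← neg_sub', map_neg]
      · have hpu : swap p q = swap u v := by
          have hp := column_eq_or hvu.symm hv.symm (heq.trans hu.symm)
          have hq := column_eq_or hvu.symm hv.symm (hc.symm.trans (heq.trans hu.symm))
          rcases hp with rfl | rfl <;> rcases hq with rfl | rfl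
          · exact absurd rfl hpq
          · rfl
          · exact swap_comm _ _
          · exact absurd rfl hpq
        rw [hpu, ← hρx, ← hρy, hswap, ← map_neg]
        congr 1
        rw [hg, map_sub, permRep_permRep, swap_mul_self, map_one, Module.End.one_apply]
        abel
    have h0 := ih (by omega) hga hgd (by omega)
    have h1 : g = 0 := by
      have := congrArg (permRep m a ρ⁻¹) h0
      rwa [permRep_permRep, inv_mul_cancel, map_one, map_zero] at this
    exact (sub_eq_zero.1 h1).symm

end Defect

/-- The orthogonal part of a harmonic function lies in `defect`; with `b = 0` the antisymmetry
condition is empty, so this part is zero. -/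
theorem harmonic_le_specht {m a : ℕ} (ha : 2 * a ≤ m) :
    harmonic m a ≤ (specht m a).toSubmodule := by
  intro h hh
  obtain ⟨p, hp, q, hq, rfl⟩ := (specht m a).toSubmodule.exists_add_mem_mem_orthogonal h
  have hq' : q ∈ harmonic m a := by
    have := sub_mem hh (specht_le_harmonic ha hp)
    rwa [add_sub_cancel_left] at this
  have : q = 0 := eq_zero_of_isAnti_of_mem_defect ha (Nat.zero_le a)
    (fun _ _ _ _ h => absurd h (Nat.not_lt_zero _)) ⟨hq', hq⟩
  rwa [this, add_zero]

/-! ### Sums of transpositions and isotypic components -/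

/-- The sum of `(x y)` over all ordered pairs, including `x = y`, of the first `i` elements,
acting on `𝓕`. -/
def stageSum (n k i : ℕ) (hi : i ≤ n) : FunSpace n k →ₗ[ℂ] FunSpace n k :=
  ∑ x : Fin i, ∑ y : Fin i, stageRep n k i hi (swap x y)

theorem stageSum_apply {n k i : ℕ} (hi : i ≤ n) (f : FunSpace n k) :
    stageSum n k i hi f = ∑ x : Fin i, ∑ y : Fin i, stageRep n k i hi (swap x y) f := by
  simp [stageSum, LinearMap.sum_apply]

theorem transSum_eq_sum_fin (i : ℕ) (f : Finset ℕ → ℂ) :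
    transSum i f = ∑ x : Fin i, ∑ y : Fin i, relabel (permNat (swap x y)) f := by
  rw [transSum_apply, sum_range]
  refine sum_congr rfl fun x _ => ?_
  rw [sum_range]
  exact sum_congr rfl fun y _ => by rw [permNat_swap]

theorem stageSum_restrict {n k i : ℕ} (hi : i ≤ n) (f : Finset ℕ → ℂ) :
    stageSum n k i hi (restrict n k f) = restrict n k (transSum i f) := by
  simp only [stageSum_apply, transSum_eq_sum_fin, map_sum, stageRep_restrict]

theorem stageSum_isSymmetric {n k i : ℕ} (hi : i ≤ n) : (stageSum n k i hi).IsSymmetric := by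
  intro f g
  rw [stageSum_apply, stageSum_apply, sum_inner, inner_sum]
  refine sum_congr rfl fun x _ => ?_
  rw [sum_inner, inner_sum]
  refine sum_congr rfl fun y _ => ?_
  have h2 : ∀ f, stageRep n k i hi (swap x y) (stageRep n k i hi (swap x y) f) = f := by
    intro f
    rw [← Module.End.mul_apply, ← map_mul, swap_mul_self, map_one, Module.End.one_apply]
  have := inner_permRep (Perm.viaEmbeddingHom (Fin.castLEEmb hi) (swap x y)) f
    (stageRep n k i hi (swap x y) g)
  rw [← this]
  congr 1
  exact (h2 g).symm

/-- The eigenspace of the sum of transpositions for the shape `(i - a, a)`. -/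
def stageEigenspace (n k i : ℕ) (hi : i ≤ n) (a : ℕ) : Submodule ℂ (FunSpace n k) :=
  Module.End.eigenspace (stageSum n k i hi) (eigval i a : ℂ)

theorem mem_stageEigenspace {n k i a : ℕ} {hi : i ≤ n} {f : FunSpace n k} :
    f ∈ stageEigenspace n k i hi a ↔ stageSum n k i hi f = (eigval i a : ℂ) • f :=
  Module.End.mem_eigenspace_iff

theorem inner_eq_zero_of_mem_stageEigenspace {n k i a b : ℕ} {hi : i ≤ n} {f g : FunSpace n k}
    (ha : 2 * a ≤ i) (hb : 2 * b ≤ i) (hab : a ≠ b) (hf : f ∈ stageEigenspace n k i hi a)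
    (hg : g ∈ stageEigenspace n k i hi b) : inner ℂ f g = 0 := by
  have h := stageSum_isSymmetric (k := k) hi f g
  rw [mem_stageEigenspace.1 hf, mem_stageEigenspace.1 hg, inner_smul_left, inner_smul_right,
    Complex.conj_ofReal, ← sub_eq_zero, ← sub_mul, mul_eq_zero] at h
  refine h.resolve_left fun h' => hab (eigval_injOn ha hb ?_)
  exact_mod_cast sub_eq_zero.1 h'

theorem sum_permRep_swap_of_mem_specht {m a : ℕ} (ha : 2 * a ≤ m) {h : FunSpace m a}
    (hh : h ∈ (specht m a).toSubmodule) :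
    ∑ x : Fin m, ∑ y : Fin m, permRep m a (swap x y) h = (eigval m a : ℂ) • h := by
  have h1 := transSum_eq_smul (extend_hasWeight h)
    (isHarmonic_iff.1 (mem_harmonic.1 (specht_le_harmonic ha hh)))
  rw [transSum_eq_sum_fin] at h1
  have h2 := congrArg (restrict m a) h1
  simpa only [map_sum, ← extend_permRep, restrict_extend, map_smul] using h2

/-- An intertwining map carries over the scalar by which the sum of transpositions acts on the
Specht module, whose elements are harmonic. -/
theorem isotypic_le_stageEigenspace {n k i a : ℕ} (hi : i ≤ n) (ha : 2 * a ≤ i) :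
    isotypic n k i hi a ≤ stageEigenspace n k i hi a := by
  refine iSup_le fun φ => iSup_le fun _ => ?_
  rintro _ ⟨v, rfl⟩
  rw [mem_stageEigenspace, stageSum_apply, ← map_smul]
  have h1 : ∀ σ, stageRep n k i hi σ (φ.toLinearMap v) =
      φ.toLinearMap ((specht i a).toRepresentation σ v) :=
    fun σ => (LinearMap.congr_fun (φ.isIntertwining' σ) v).symm
  simp only [h1, ← map_sum]
  congr 1
  refine Subtype.ext ?_
  have := sum_permRep_swap_of_mem_specht ha v.2
  simp only [Submodule.coe_sum, Submodule.coe_smul]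
  exact this

theorem restrict_ne_zero {n k : ℕ} {f : Finset ℕ → ℂ}
    (hf : ∀ z, f z ≠ 0 → z ⊆ range n ∧ #z = k) (h : f ≠ 0) : restrict n k f ≠ 0 := by
  intro h0
  apply h
  rw [← extend_restrict hf, h0, map_zero]

theorem attach_raise_pow_support_slice {n k i a m : ℕ} (hi : i ≤ n) {f : Finset ℕ → ℂ}
    (hf : ∀ z, f z ≠ 0 → z ⊆ range i) (ha : HasWeight i a f) {w : Finset ℕ}
    (hwn : w ⊆ range n) (hk : a + m + #w = k) (z : Finset ℕ)
    (hz : attach w ((raise i ^ m) f) z ≠ 0) : z ⊆ range n ∧ #z = k := by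
  obtain ⟨h1, h2⟩ := attach_raise_pow_support hf ha m hz
  refine ⟨fun y hy => ?_, h1.trans hk⟩
  rcases lt_or_ge y i with h | h
  · exact mem_range.2 (h.trans_le hi)
  · exact hwn ((h2 y h).1 hy)

/-- The map that raises `m` times and adjoins `w` embeds the Specht module of `S_i` into `𝓕`. -/
theorem restrict_attach_raise_pow_mem_isotypic {n k i a m : ℕ} (hi : i ≤ n) (ha : 2 * a + m ≤ i)
    {w : Finset ℕ} (hw : ∀ x ∈ w, i ≤ x) (hwn : w ⊆ range n) (hk : a + m + #w = k)
    {f : Finset ℕ → ℂ} (hf : ∀ z, f z ≠ 0 → z ⊆ range i ∧ #z = a) (h0 : lower i f = 0) :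
    restrict n k (attach w ((raise i ^ m) f)) ∈ isotypic n k i hi a := by
  have ha' : 2 * a ≤ i := by omega
  let ψ : FunSpace i a →ₗ[ℂ] FunSpace n k :=
    restrict n k ∘ₗ attach w ∘ₗ (raise i ^ m) ∘ₗ extend i a
  have hψ : ∀ (σ : Perm (Fin i)) (h : FunSpace i a),
      ψ (permRep i a σ h) = stageRep n k i hi σ (ψ h) := by
    intro σ h
    simp only [ψ, LinearMap.comp_apply]
    rw [stageRep_restrict, relabel_attach (permNat_smul_of_le σ hw), relabel_raise_pow (permNat_smul_range σ le_rfl),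
      extend_permRep]
  let φ : (specht i a).toRepresentation.IntertwiningMap (stageRep n k i hi) :=
    { toLinearMap := ψ ∘ₗ (specht i a).toSubmodule.subtype
      isIntertwining' := fun σ => by
        ext1 v
        exact hψ σ v.1 }
  have hinj : Function.Injective φ.toLinearMap := by
    rw [injective_iff_map_eq_zero]
    intro v hv
    have hv1 := fun z hz => (extend_support v.1 z hz).1
    have hv2 := isHarmonic_iff.1 (mem_harmonic.1 (specht_le_harmonic ha' v.2))
    have hv3 := extend_hasWeight v.1
    by_contra hne
    refine restrict_ne_zero (attach_raise_pow_support_slice hi hv1 hv3 hwn hk) ?_ hv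
    intro h
    have := eq_zero_of_attach_raise_pow_eq_zero hv1 hv3 hv2 ha hw h
    apply hne
    refine Subtype.ext ?_
    rw [← restrict_extend v.1, this, map_zero]
    rfl
  -- Here the harmonic functions must be no more than the Specht module: a vector killed by `lower
  -- i` has to lie in the domain of `φ`.
  have hmem : restrict i a f ∈ (specht i a).toSubmodule := by
    refine harmonic_le_specht ha' (mem_harmonic.2 (isHarmonic_iff.2 ?_))
    rw [extend_restrict hf, h0]
  refine Submodule.mem_iSup_of_mem φ (Submodule.mem_iSup_of_mem hinj ⟨⟨_, hmem⟩, ?_⟩)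
  change restrict n k (attach w ((raise i ^ m) (extend i a (restrict i a f)))) = _
  rw [extend_restrict hf]

/-! ### The vectors with given labels -/

namespace Label

variable {n k i : ℕ}

theorem two_mul_secondLength_le (l : Label n k i) {j : ℕ} (hj : j ≤ i) :
    2 * l.secondLength j ≤ j := l.standard j hj

theorem card_filter_val (s : Finset (Fin n)) (j : ℕ) :
    #(range j ∩ s.map Fin.valEmbedding) = #(s.filter fun x : Fin n => (x : ℕ) < j) := by
  rw [← card_map Fin.valEmbedding]
  congr 1
  ext x
  simp only [mem_inter, mem_range, mem_map, mem_filter, Fin.valEmbedding_apply]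
  constructor
  · rintro ⟨h, y, hy, rfl⟩; exact ⟨y, ⟨hy, h⟩, rfl⟩
  · rintro ⟨y, ⟨hy, h⟩, rfl⟩; exact ⟨h, y, hy, rfl⟩

theorem card_filter_lt_succ (s : Finset (Fin n)) (x : Fin n) :
    #(s.filter fun y : Fin n => (y : ℕ) < x + 1) =
      #(s.filter fun y : Fin n => (y : ℕ) < x) + if x ∈ s then 1 else 0 := by
  rw [← card_filter_val, ← card_filter_val]
  split_ifs with h
  · exact range_succ_inter_of_mem (mem_map_of_mem Fin.valEmbedding h)
  · rw [range_succ_inter_of_notMem, add_zero]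
    rw [mem_map]
    rintro ⟨y, hy, hyx⟩
    exact h (Fin.ext hyx ▸ hy)

/-- The lengths of the second rows determine the second row. -/
theorem mem_iff_of_card_filter_eq {s t : Finset (Fin n)}
    (h : ∀ j, 1 ≤ j → j ≤ i → #(s.filter fun y : Fin n => (y : ℕ) < j) =
      #(t.filter fun y : Fin n => (y : ℕ) < j)) {x : Fin n} (hx : (x : ℕ) < i) :
    x ∈ s ↔ x ∈ t := by
  have h1 := h (x + 1) (by omega) hx
  have h2 : #(s.filter fun y : Fin n => (y : ℕ) < x) = #(t.filter fun y : Fin n => (y : ℕ) < x) := by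
    rcases Nat.eq_zero_or_pos (x : ℕ) with h0 | h0
    · simp [h0]
    · exact h x h0 hx.le
  rw [card_filter_lt_succ, card_filter_lt_succ, h2] at h1
  split_ifs at h1 <;> simp_all

theorem filter_lt_eq (l : Label n k i) : (l.second.filter fun x : Fin n => (x : ℕ) < i) = l.second :=
  filter_true_of_mem l.second_lt

theorem secondLength_self (l : Label n k i) : l.secondLength i = #l.second := by
  rw [secondLength, filter_lt_eq]

theorem two_mul_card_second_le (l : Label n k i) : 2 * #l.second ≤ i := by
  rw [← l.secondLength_self]
  exact l.two_mul_secondLength_le le_rfl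

/-- A nonzero vector with the given label. -/
def vec (l : Label n k i) : FunSpace n k :=
  -- The tableau vector lives on `a`-sets and `r = k - #l.ones` elements are wanted besides `w`,
  -- hence `r - a` raisings; `shape_le` rules out truncation.
  restrict n k (gtFun (l.second.map Fin.valEmbedding) (l.ones.map Fin.valEmbedding) i
    (k - #l.ones - #l.second))

theorem le_of_mem_ones (l : Label n k i) : ∀ x ∈ l.ones.map Fin.valEmbedding, i ≤ x := by
  intro x hx
  obtain ⟨y, hy, rfl⟩ := mem_map.1 hx
  exact l.le_ones y hy

theorem ones_subset (l : Label n k i) : l.ones.map Fin.valEmbedding ⊆ range n := by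
  intro x hx
  obtain ⟨y, hy, rfl⟩ := mem_map.1 hx
  exact mem_range.2 y.isLt

theorem vec_mem_stageEigenspace (hi : i ≤ n) (l : Label n k i) {j : ℕ} (hj : j ≤ i) :
    l.vec ∈ stageEigenspace n k j (hj.trans hi) (l.secondLength j) := by
  rw [mem_stageEigenspace, vec, stageSum_restrict, transSum_gtFun hj l.le_of_mem_ones, map_smul,
    card_filter_val]
  rfl

theorem weight_eq (l : Label n k i) :
    #(range i ∩ l.second.map Fin.valEmbedding) = #l.second := by
  rw [card_filter_val, filter_lt_eq]

theorem add_eq (l : Label n k i) :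
    #l.second + (k - #l.ones - #l.second) + #(l.ones.map Fin.valEmbedding) = k := by
  have := l.shape_le
  rw [card_map]
  omega

theorem two_mul_add_le (l : Label n k i) : 2 * #l.second + (k - #l.ones - #l.second) ≤ i := by
  have := l.shape_le
  have := l.shape_le'
  omega

theorem vec_mem_isotypic (hi : i ≤ n) (l : Label n k i) :
    l.vec ∈ isotypic n k i hi #l.second := by
  refine restrict_attach_raise_pow_mem_isotypic hi l.two_mul_add_le l.le_of_mem_ones l.ones_subset
    l.add_eq (fun z hz => ?_) (lower_gtVec _ _)
  have := gtVec_support _ _ hz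
  rwa [weight_eq] at this

theorem vec_ne_zero (hi : i ≤ n) (l : Label n k i) : l.vec ≠ 0 := by
  have h1 : ∀ z, gtVec (l.second.map Fin.valEmbedding) i z ≠ 0 → z ⊆ range i :=
    fun z hz => (gtVec_support _ _ hz).1
  have h2 := gtVec_hasWeight (l.second.map Fin.valEmbedding) i
  rw [weight_eq] at h2
  refine restrict_ne_zero (attach_raise_pow_support_slice hi h1 h2 l.ones_subset l.add_eq) ?_
  intro h
  refine gtVec_ne_zero (fun j hj => ?_) (eq_zero_of_attach_raise_pow_eq_zero h1 h2
    (lower_gtVec _ _) l.two_mul_add_le l.le_of_mem_ones h)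
  rw [card_filter_val]
  exact l.standard j hj

theorem mem_wordSpace {l : Label n k i} {f : FunSpace n k} :
    f ∈ l.wordSpace ↔ ∀ x : KSet n k, f x ≠ 0 → ∀ y : Fin n, i ≤ (y : ℕ) → (y ∈ x ↔ y ∈ l.ones) := by
  constructor
  · intro hf
    induction hf using Submodule.span_induction with
    | mem g hg =>
      obtain ⟨x, hx, rfl⟩ := hg
      intro x' hx'
      by_cases h : x' = x
      · exact h ▸ hx
      · simp [delta, h] at hx'
    | zero => intro x hx; simp at hx
    | add g g' _ _ hg hg' =>
      intro x hx
      by_cases h : g x = 0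
      · refine hg' x fun h' => hx ?_
        rw [PiLp.add_apply, h, h', add_zero]
      · exact hg x h
    | smul c g _ hg =>
      intro x hx
      exact hg x fun h => hx (by rw [PiLp.smul_apply, h, smul_zero])
  · intro hf
    have h1 : f = ∑ x, f x • delta x := by
      ext y
      classical
      simp [delta, Pi.single_apply]
    rw [h1]
    refine sum_mem fun x _ => ?_
    by_cases h : f x = 0
    · rw [h, zero_smul]; exact zero_mem _
    · exact Submodule.smul_mem _ _ (Submodule.subset_span ⟨x, hf x h, rfl⟩)

theorem vec_mem_wordSpace (l : Label n k i) : l.vec ∈ l.wordSpace := by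
  rw [mem_wordSpace]
  intro x hx y hy
  have h1 : ∀ z, gtVec (l.second.map Fin.valEmbedding) i z ≠ 0 → z ⊆ range i :=
    fun z hz => (gtVec_support _ _ hz).1
  have := (attach_raise_pow_support h1 (gtVec_hasWeight _ i) _ hx).2 y hy
  have hmem : ∀ s : Finset (Fin n), (y : ℕ) ∈ s.map Fin.valEmbedding ↔ y ∈ s :=
    fun s => mem_map' Fin.valEmbedding
  rwa [hmem, hmem] at this

theorem ext_of_secondLength {l l' : Label n k i}
    (h : ∀ j, 1 ≤ j → j ≤ i → l.secondLength j = l'.secondLength j) (h' : l.ones = l'.ones) :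
    l = l' := by
  refine ext_pair (Prod.ext ?_ h')
  ext x
  by_cases hx : (x : ℕ) < i
  · exact mem_iff_of_card_filter_eq h hx
  · exact iff_of_false (fun hl => hx (l.second_lt x hl)) fun hl => hx (l'.second_lt x hl)

/-- Functions supported on words with different endings are orthogonal. -/
theorem inner_eq_zero_of_wordSpace {i' : ℕ} {l : Label n k i} {l' : Label n k i'}
    {f g : FunSpace n k} (hf : f ∈ l.wordSpace) (hg : g ∈ l'.wordSpace) {y : Fin n}
    (hi : i ≤ (y : ℕ)) (hi' : i' ≤ (y : ℕ)) (hy : ¬ (y ∈ l.ones ↔ y ∈ l'.ones)) :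
    inner ℂ f g = 0 := by
  rw [PiLp.inner_apply]
  refine sum_eq_zero fun x _ => ?_
  by_cases h1 : f x = 0
  · simp [h1]
  · by_cases h2 : g x = 0
    · simp [h2]
    · exact absurd ((mem_wordSpace.1 hf x h1 y hi).symm.trans (mem_wordSpace.1 hg x h2 y hi')) hy

/-- Different words give disjoint supports; different tableaux give different eigenvalues at some
level `j`. -/
theorem inner_vec (hi : i ≤ n) {l l' : Label n k i} (h : l ≠ l') :
    inner ℂ l.vec l'.vec = 0 := by
  by_cases h1 : l.ones = l'.ones
  · obtain ⟨j, hj, hne⟩ : ∃ j, j ≤ i ∧ l.secondLength j ≠ l'.secondLength j := by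
      by_contra! h2
      exact h (ext_of_secondLength (fun j _ hj => h2 j hj) h1)
    exact inner_eq_zero_of_mem_stageEigenspace (l.two_mul_secondLength_le hj)
      (l'.two_mul_secondLength_le hj) hne (l.vec_mem_stageEigenspace hi hj)
      (l'.vec_mem_stageEigenspace hi hj)
  · obtain ⟨y, hy⟩ : ∃ y, ¬ (y ∈ l.ones ↔ y ∈ l'.ones) := by
      by_contra! h2
      exact h1 (Finset.ext h2)
    have hyi : i ≤ (y : ℕ) := by
      by_contra h3
      exact hy (iff_of_false (fun h => h3 (l.le_ones y h)) fun h => h3 (l'.le_ones y h))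
    exact inner_eq_zero_of_wordSpace l.vec_mem_wordSpace l'.vec_mem_wordSpace hyi hyi hy

end Label

namespace Label

variable {n k i : ℕ}

/-! ### The number of labels -/

/-- Labels at consecutive levels: the letter at the place `i` becomes an entry of the tableau. -/
theorem exists_injective_succ (n k i : ℕ) (hi : i < n) :
    ∃ F : Label n k i → Label n k (i + 1), Function.Injective F := by
  let p : Fin n := ⟨i, hi⟩
  have hps : ∀ l : Label n k i, p ∉ l.second := fun l h => (l.second_lt p h).false
  have hlt : ∀ {s : Finset (Fin n)}, (∀ x ∈ s, (x : ℕ) < i) → ∀ x ∈ s, (x : ℕ) < i + 1 :=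
    fun h x hx => (h x hx).trans i.lt_succ_self
  have hstd : ∀ (l : Label n k i) (j : ℕ), j ≤ i + 1 →
      2 * #(l.second.filter fun x : Fin n => (x : ℕ) < j) ≤ j := by
    intro l j hj
    rcases Nat.of_le_succ hj with h | rfl
    · exact l.standard j h
    · rw [filter_true_of_mem (hlt l.second_lt)]
      exact l.two_mul_card_second_le.trans i.le_succ
  have hone : ∀ (l : Label n k i), p ∉ l.ones → ∀ x ∈ l.ones, i + 1 ≤ (x : ℕ) := by
    intro l hp x hx
    refine lt_of_le_of_ne (l.le_ones x hx) fun h => hp ?_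
    have : p = x := Fin.ext h
    rwa [this]
  -- A letter `1` becomes a first-row entry. A letter `2` becomes a second-row entry if `a < r`, and
  -- a first-row entry if `a = r`.
  have hex : ∀ l : Label n k i, ∃ l' : Label n k (i + 1),
      (p ∈ l.ones → l'.second = l.second ∧ l'.ones = l.ones.erase p) ∧
      (p ∉ l.ones → #l.second + #l.ones + 1 ≤ k →
        l'.second = insert p l.second ∧ l'.ones = l.ones) ∧
      (p ∉ l.ones → ¬ #l.second + #l.ones + 1 ≤ k → l'.second = l.second ∧ l'.ones = l.ones) := by
    intro l
    have h1 := l.shape_le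
    have h2 := l.shape_le'
    by_cases hp : p ∈ l.ones
    · have h3 := card_erase_add_one hp
      refine ⟨⟨l.second, l.ones.erase p, hlt l.second_lt, fun x hx => ?_, hstd l, by omega,
        by omega⟩, fun _ => ⟨rfl, rfl⟩, fun h => absurd hp h, fun h => absurd hp h⟩
      rw [mem_erase] at hx
      refine lt_of_le_of_ne (l.le_ones x hx.2) fun h => hx.1 (Fin.ext h.symm)
    · by_cases hk : #l.second + #l.ones + 1 ≤ k
      · have h3 := card_insert_of_notMem (hps l)
        have h4 : ∀ x ∈ insert p l.second, (x : ℕ) < i + 1 := by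
          intro x hx
          rcases mem_insert.1 hx with rfl | hx
          · exact i.lt_succ_self
          · exact hlt l.second_lt x hx
        refine ⟨⟨insert p l.second, l.ones, h4, hone l hp, fun j hj => ?_, by omega, by omega⟩,
          fun h => absurd h hp, fun _ _ => ⟨rfl, rfl⟩, fun _ h => absurd hk h⟩
        rcases Nat.of_le_succ hj with h | rfl
        · rw [filter_insert, if_neg (by simpa [p] using h)]
          exact l.standard j h
        · rw [filter_true_of_mem h4, h3]
          omega
      · exact ⟨⟨l.second, l.ones, hlt l.second_lt, hone l hp, hstd l, by omega, by omega⟩,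
          fun h => absurd h hp, fun _ h => absurd h hk, fun _ _ => ⟨rfl, rfl⟩⟩
  choose F hF1 hF2 hF3 using hex
  refine ⟨F, fun l l' h => ext_pair ?_⟩
  -- The images of a letter `1` and a letter `2` differ: they could agree only with the new entry in
  -- the first row, but then the second label has one letter `1` fewer in its word, so its `a` is
  -- less than its `r`, against the rule for `2`.
  have key : ∀ l l' : Label n k i, F l = F l' → p ∈ l.ones → p ∉ l'.ones → False := by
    intro l l' h hp hp'
    obtain ⟨h1, h2⟩ := hF1 l hp
    have := card_erase_add_one hp
    have := l.shape_le
    by_cases hc : #l'.second + #l'.ones + 1 ≤ k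
    · obtain ⟨h3, h4⟩ := hF2 l' hp' hc
      apply hps l
      rw [← h1, h, h3]
      exact mem_insert_self _ _
    · obtain ⟨h3, h4⟩ := hF3 l' hp' hc
      rw [← h, h1] at h3
      rw [← h, h2] at h4
      rw [← h3, ← h4] at hc
      omega
  by_cases hp : p ∈ l.ones <;> by_cases hp' : p ∈ l'.ones
  · obtain ⟨h1, h2⟩ := hF1 l hp
    obtain ⟨h3, h4⟩ := hF1 l' hp'
    rw [← h, h1] at h3
    rw [← h, h2] at h4
    exact Prod.ext h3 (by simpa only [insert_erase, hp, hp'] using congrArg (insert p) h4)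
  · exact (key l l' h hp hp').elim
  · exact (key l' l h.symm hp' hp).elim
  · have ho : l.ones = l'.ones := by
      have h1 : (F l).ones = l.ones := by
        by_cases hc : #l.second + #l.ones + 1 ≤ k
        · exact (hF2 l hp hc).2
        · exact (hF3 l hp hc).2
      have h2 : (F l').ones = l'.ones := by
        by_cases hc : #l'.second + #l'.ones + 1 ≤ k
        · exact (hF2 l' hp' hc).2
        · exact (hF3 l' hp' hc).2
      rw [← h1, h, h2]
    have he : ∀ l : Label n k i, p ∉ l.ones → l.second = (F l).second.erase p := by
      intro l hp
      by_cases hc : #l.second + #l.ones + 1 ≤ k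
      · rw [(hF2 l hp hc).1, erase_insert (hps l)]
      · rw [(hF3 l hp hc).1, erase_eq_of_notMem (hps l)]
    exact Prod.ext ((he l hp).trans (h ▸ (he l' hp').symm)) ho

/-- A `k`-set is determined by its elements other than the first. -/
theorem kset_ext {x x' : KSet n k} (h : ∀ y : Fin n, 1 ≤ (y : ℕ) → (y ∈ x ↔ y ∈ x')) : x = x' := by
  have key : ∀ x x' : KSet n k, (∀ y : Fin n, 1 ≤ (y : ℕ) → (y ∈ x ↔ y ∈ x')) →
      ∀ z ∈ x, z ∈ x' := by
    intro x x' h z hz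
    by_contra hz'
    have hz0 : ¬ 1 ≤ (z : ℕ) := fun h' => hz' ((h z h').1 hz)
    have h1 : (x' : Finset (Fin n)) ⊂ x := by
      refine (ssubset_iff_of_subset fun y hy => ?_).2 ⟨z, hz, hz'⟩
      refine (h y ?_).2 hy
      by_contra hy0
      have : y = z := Fin.ext (by omega)
      exact hz' (this ▸ hy)
    have h2 := card_lt_card h1
    rw [Set.powersetCard.card_eq, Set.powersetCard.card_eq] at h2
    exact h2.false
  exact Set.powersetCard.eq_iff_subset.2 fun z hz => key x x' h z hz

theorem card_kset (n k : ℕ) : Fintype.card (KSet n k) = n.choose k := by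
  rw [← Nat.card_eq_fintype_card, Set.powersetCard.card, Nat.card_fin]

/-- With one box the tableau carries no information, and the omitted first letter is recovered from
`k`. -/
theorem choose_le_card_one (n k : ℕ) : n.choose k ≤ Fintype.card (Label n k 1) := by
  rw [← card_kset]
  have hsub : ∀ x : KSet n k, #((x : Finset (Fin n)).filter fun y : Fin n => ¬ 1 ≤ (y : ℕ)) ≤ 1 := by
    intro x
    rw [card_le_one]
    intro y hy z hz
    rw [mem_filter] at hy hz
    exact Fin.ext (by omega)
  have hcard : ∀ x : KSet n k, #((x : Finset (Fin n)).filter fun y : Fin n => 1 ≤ (y : ℕ)) +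
      #((x : Finset (Fin n)).filter fun y : Fin n => ¬ 1 ≤ (y : ℕ)) = k := by
    intro x
    rw [card_filter_add_card_filter_not, Set.powersetCard.card_eq]
  refine Fintype.card_le_of_injective (fun x : KSet n k =>
    (⟨∅, (x : Finset (Fin n)).filter fun y : Fin n => 1 ≤ (y : ℕ), by simp, by simp, by simp, ?_, ?_⟩ :
      Label n k 1)) ?_
  · have := hcard x
    rw [card_empty]
    omega
  · have := hcard x
    have := hsub x
    rw [card_empty]
    omega
  · intro x x' h
    refine kset_ext fun y hy => ?_
    have := Finset.ext_iff.1 (congrArg Label.ones h) y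
    simp only [mem_filter, hy, and_true] at this
    exact this

theorem choose_le_card (k : ℕ) (h1 : 1 ≤ i) (hi : i ≤ n) :
    n.choose k ≤ Fintype.card (Label n k i) := by
  induction i, h1 using Nat.le_induction with
  | base => exact choose_le_card_one n k
  | succ i _ ih =>
    obtain ⟨F, hF⟩ := exists_injective_succ n k i hi
    exact (ih (by omega)).trans (Fintype.card_le_of_injective F hF)

/-! ### Bases of vectors with given labels -/

/-- At level `1` the word leaves a single `k`-set, so the vector is a multiple of a delta function;
dividing by its value there, not just by its norm, fixes the phase as `B_1 = B_0` demands. -/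
theorem exists_unit_vec (hi : i ≤ n) (l : Label n k i) :
    ∃ u : FunSpace n k, ‖u‖ = 1 ∧ (∃ c : ℂ, u = c • l.vec) ∧ (i = 1 → ∃ x, u = delta x) := by
  by_cases h1 : i = 1
  · subst h1
    obtain ⟨x, hx⟩ : ∃ x, l.vec x ≠ 0 := by
      by_contra! h
      exact l.vec_ne_zero hi (by ext x; exact h x)
    refine ⟨delta x, by simp [delta], ⟨(l.vec x)⁻¹, ?_⟩, fun _ => ⟨x, rfl⟩⟩
    ext y
    by_cases hxy : y = x
    · subst hxy; simp [delta, hx]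
    · have : l.vec y = 0 := by
        by_contra hy
        refine hxy (kset_ext fun z hz => ?_)
        have hw := mem_wordSpace.1 l.vec_mem_wordSpace
        exact (hw y hy z hz).trans (hw x hx z hz).symm
      simp [delta, hxy, this]
  · exact ⟨((‖l.vec‖ : ℂ)⁻¹) • l.vec, norm_smul_inv_norm (l.vec_ne_zero hi), ⟨_, rfl⟩,
      fun h => absurd h h1⟩

/-- Orthonormality bounds the number of labels above by the dimension, and `choose_le_card` bounds
it below, so the family spans. -/
theorem exists_orthonormalBasis (h1 : 1 ≤ i) (hi : i ≤ n) :
    ∃ b : OrthonormalBasis (Label n k i) ℂ (FunSpace n k),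
      ∀ l, (∃ c : ℂ, b l = c • l.vec) ∧ (i = 1 → ∃ x, b l = delta x) := by
  choose u hu1 hu2 hu3 using fun l : Label n k i => l.exists_unit_vec hi
  have hon : Orthonormal ℂ u := by
    refine ⟨hu1, fun l l' hl => ?_⟩
    obtain ⟨c, hc⟩ := hu2 l
    obtain ⟨c', hc'⟩ := hu2 l'
    rw [hc, hc', inner_smul_left, inner_smul_right, inner_vec hi hl, mul_zero, mul_zero]
  have hcard : Fintype.card (Label n k i) = Module.finrank ℂ (FunSpace n k) := by
    refine le_antisymm hon.linearIndependent.fintype_card_le_finrank ?_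
    rw [finrank_euclideanSpace, card_kset]
    exact choose_le_card k h1 hi
  refine ⟨OrthonormalBasis.mk hon
    (hon.linearIndependent.span_eq_top_of_card_eq_finrank' hcard).ge, fun l => ?_⟩
  rw [OrthonormalBasis.coe_mk]
  exact ⟨hu2 l, hu3 l⟩

theorem card_eq_choose (k : ℕ) (h1 : 1 ≤ i) (hi : i ≤ n) :
    Fintype.card (Label n k i) = n.choose k := by
  obtain ⟨b, -⟩ := exists_orthonormalBasis (k := k) h1 hi
  rw [← Module.finrank_eq_card_basis b.toBasis, finrank_euclideanSpace, card_kset]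

end Label

/-- The basis of level `i` consists of vectors in isotypic components, and those of another shape
are orthogonal to the eigenspace. Thus a labelled vector, an eigenvector for every `j ≤ i`, lies in
every component that `Label.space` requires. -/
theorem isotypic_eq_stageEigenspace {n k i a : ℕ} (h1 : 1 ≤ i) (hi : i ≤ n) (ha : 2 * a ≤ i) :
    isotypic n k i hi a = stageEigenspace n k i hi a := by
  refine le_antisymm (isotypic_le_stageEigenspace hi ha) fun f hf => ?_
  obtain ⟨b, hb⟩ := Label.exists_orthonormalBasis (k := k) h1 hi
  rw [← b.sum_repr' f]
  refine sum_mem fun l _ => ?_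
  have hl : b l ∈ isotypic n k i hi #l.second := by
    obtain ⟨⟨c, hc⟩, -⟩ := hb l
    rw [hc]
    exact Submodule.smul_mem _ _ (l.vec_mem_isotypic hi)
  by_cases h : #l.second = a
  · exact Submodule.smul_mem _ _ (h ▸ hl)
  · rw [inner_eq_zero_of_mem_stageEigenspace l.two_mul_card_second_le ha h
      (isotypic_le_stageEigenspace hi l.two_mul_card_second_le hl) hf, zero_smul]
    exact zero_mem _

theorem inner_eq_zero_of_mem_isotypic {n k i a b : ℕ} {hi : i ≤ n} {f g : FunSpace n k}
    (ha : 2 * a ≤ i) (hb : 2 * b ≤ i) (hab : a ≠ b) (hf : f ∈ isotypic n k i hi a)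
    (hg : g ∈ isotypic n k i hi b) : inner ℂ f g = 0 :=
  inner_eq_zero_of_mem_stageEigenspace ha hb hab (isotypic_le_stageEigenspace hi ha hf)
    (isotypic_le_stageEigenspace hi hb hg)

theorem Label.vec_mem_space {n k i : ℕ} (hi : i ≤ n) (l : Label n k i) : l.vec ∈ l.space hi := by
  refine ⟨?_, l.vec_mem_wordSpace⟩
  simp only [SetLike.mem_coe, Submodule.mem_iInf]
  intro j h1 hj
  rw [isotypic_eq_stageEigenspace h1 _ (l.two_mul_secondLength_le hj)]
  exact l.vec_mem_stageEigenspace hi hj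

theorem nonempty_intermediateBases (n k : ℕ) : Nonempty (IntermediateBases n k) := by
  choose b hb using fun i : Fin n =>
    Label.exists_orthonormalBasis (n := n) (k := k) (i := i + 1) (by omega) i.isLt
  refine ⟨⟨b, fun i l => ?_, fun h l => (hb ⟨0, h⟩ l).2 rfl⟩⟩
  obtain ⟨⟨c, hc⟩, -⟩ := hb i l
  rw [hc]
  exact Submodule.smul_mem _ _ (l.vec_mem_space i.isLt)

/-! ### The isotypic decomposition -/

theorem Label.mem_isotypic_of_mem_space {n k i j : ℕ} (hi : i ≤ n) {l : Label n k i}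
    {f : FunSpace n k} (hf : f ∈ l.space hi) (h1 : 1 ≤ j) (hj : j ≤ i) :
    f ∈ isotypic n k j (hj.trans hi) (l.secondLength j) := by
  have := hf.1
  simp only [SetLike.mem_coe, Submodule.mem_iInf] at this
  exact this j h1 hj

theorem Label.card_second_le_min {n k : ℕ} (l : Label n k n) : #l.second ≤ min k (n - k) := by
  have h0 : l.ones = ∅ := eq_empty_of_forall_notMem fun x hx => (l.le_ones x hx).not_gt x.isLt
  have h1 := l.shape_le
  have h2 := l.shape_le'
  rw [h0, card_empty] at h1 h2
  omega

/-- The differences of corresponding terms are pairwise orthogonal and add up to zero. -/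
theorem IsDecomposition.unique {n k : ℕ} {f : FunSpace n k}
    {g g' : Fin (min k (n - k) + 1) → FunSpace n k} (hg : IsDecomposition f g)
    (hg' : IsDecomposition f g') : g = g' := by
  ext1 a
  rw [← sub_eq_zero]
  have h1 : ∑ b, (g b - g' b) = 0 := by
    rw [sum_sub_distrib, ← hg.2, ← hg'.2, sub_self]
  have h2 : ∀ b, b ≠ a → inner ℂ (g a - g' a) (g b - g' b) = 0 := by
    intro b hb
    refine inner_eq_zero_of_mem_isotypic (a := a) (b := b) ?_ ?_ ?_
      (sub_mem (hg.1 a) (hg'.1 a)) (sub_mem (hg.1 b) (hg'.1 b))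
    · omega
    · omega
    · exact fun h => hb (Fin.ext h.symm)
  have h3 : inner ℂ (g a - g' a) (∑ b, (g b - g' b)) = inner ℂ (g a - g' a) (g a - g' a) := by
    rw [inner_sum, sum_eq_single a (fun b _ hb => h2 b hb) (by simp)]
  rw [h1, inner_zero_right] at h3
  exact inner_self_eq_zero.1 h3.symm

/-- The projection of `f` to the span of the basis vectors whose tableau has `a` boxes in the
second row. -/
def component {n k : ℕ} (b : OrthonormalBasis (Label n k n) ℂ (FunSpace n k)) (f : FunSpace n k)
    (a : ℕ) : FunSpace n k :=
  ∑ l with #l.second = a, inner ℂ (b l) f • b l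

theorem isDecomposition_component {n k : ℕ} (h1 : 1 ≤ n)
    (b : OrthonormalBasis (Label n k n) ℂ (FunSpace n k)) (hb : ∀ l, b l ∈ l.space le_rfl)
    (f : FunSpace n k) :
    IsDecomposition f fun a : Fin (min k (n - k) + 1) => component b f a := by
  constructor
  · intro a
    refine sum_mem fun l hl => Submodule.smul_mem _ _ ?_
    have := l.mem_isotypic_of_mem_space le_rfl (hb l) h1 le_rfl
    rwa [l.secondLength_self, (mem_filter.1 hl).2] at this
  · rw [Fin.sum_univ_eq_sum_range (fun a => component b f a)]
    conv_lhs => rw [← b.sum_repr' f]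
    refine (sum_fiberwise_of_maps_to (fun l _ => ?_) _).symm
    rw [mem_range]
    exact Nat.lt_succ_of_le l.card_second_le_min

theorem norm_component_sq {n k : ℕ} (b : OrthonormalBasis (Label n k n) ℂ (FunSpace n k))
    (f : FunSpace n k) (a : ℕ) :
    ((‖component b f a‖ ^ 2 : ℝ) : ℂ) =
      ∑ l with #l.second = a, inner ℂ (b l) f * (starRingEnd ℂ) (inner ℂ (b l) f) := by
  have h : inner ℂ (component b f a) (component b f a) = ∑ l with #l.second = a,
      (starRingEnd ℂ) (inner ℂ (b l) f) * inner ℂ (b l) f :=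
    b.orthonormal.inner_sum _ _ _
  rw [inner_self_eq_norm_sq_to_K] at h
  push_cast
  rw [sum_congr rfl fun l _ => mul_comm _ _]
  exact h

/-! ### Building straight-line programs -/

/-- The results of a list of operations. -/
def opResults {I : Type} (ops : List (Op I)) (inp : I → ℂ) : List ℂ :=
  ops.foldl (fun mem c => mem ++ [c.eval inp mem]) []

section Programs

variable {I ι : Type} {inp : ι → I → ℂ}

theorem opResults_concat (ops : List (Op I)) (c : Op I) (v : I → ℂ) :
    opResults (ops ++ [c]) v = opResults ops v ++ [c.eval v (opResults ops v)] := by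
  simp [opResults, List.foldl_append]

theorem length_opResults (ops : List (Op I)) (v : I → ℂ) :
    (opResults ops v).length = ops.length := by
  induction ops using List.reverseRecOn with
  | nil => rfl
  | append_singleton ops c ih => rw [opResults_concat]; simp [ih]

theorem opResults_append (ops ops' : List (Op I)) (v : I → ℂ) :
    ∃ r, opResults (ops ++ ops') v = opResults ops v ++ r := by
  induction ops' using List.reverseRecOn with
  | nil => exact ⟨[], by simp⟩
  | append_singleton ops' c ih =>
    obtain ⟨r, hr⟩ := ih
    rw [← List.append_assoc, opResults_concat, hr, List.append_assoc]
    exact ⟨_, rfl⟩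

/-- After the operations `ops`, and any further ones, the operand `o` has the value `val t` for
the input `inp t`, for every `t`. -/
def Computes (inp : ι → I → ℂ) (ops : List (Op I)) (o : Operand I) (val : ι → ℂ) : Prop :=
  ∀ t r, o.eval (inp t) (opResults ops (inp t) ++ r) = val t

theorem Computes.append {ops : List (Op I)} {o : Operand I} {val : ι → ℂ}
    (h : Computes inp ops o val) (ops' : List (Op I)) : Computes inp (ops ++ ops') o val := by
  intro t r
  obtain ⟨r', hr⟩ := opResults_append ops ops' (inp t)
  rw [hr, List.append_assoc]
  exact h t _

theorem computes_zero (inp : ι → I → ℂ) (ops : List (Op I)) :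
    Computes inp ops .zero fun _ => 0 := fun _ _ => rfl

theorem computes_concat {ops : List (Op I)} {c : Op I} {val : ι → ℂ}
    (h : ∀ t, c.eval (inp t) (opResults ops (inp t)) = val t) :
    Computes inp (ops ++ [c]) (.result ops.length) val := by
  intro t r
  rw [opResults_concat, h, ← length_opResults ops (inp t)]
  simp [Operand.eval]

theorem Computes.eval {ops : List (Op I)} {o : Operand I} {val : ι → ℂ}
    (h : Computes inp ops o val) (t : ι) : o.eval (inp t) (opResults ops (inp t)) = val t := by
  simpa using h t []

/-- A sum of products costs one operation for each product. -/
theorem exists_computes_sum_mul {L : Type*} (s : Finset L) {ops : List (Op I)}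
    {p q : L → Operand I} {f g : L → ι → ℂ} (hf : ∀ l ∈ s, Computes inp ops (p l) (f l))
    (hg : ∀ l ∈ s, Computes inp ops (q l) (g l)) :
    ∃ ops', ops'.length = #s ∧ ∃ o, Computes inp (ops ++ ops') o fun t => ∑ l ∈ s, f l t * g l t := by
  classical
  induction s using Finset.induction_on with
  | empty => exact ⟨[], rfl, .zero, by simpa using computes_zero inp ops⟩
  | insert l s hl ih =>
    obtain ⟨ops', hlen, o, ho⟩ := ih (fun l' h => hf l' (mem_insert_of_mem h))
      fun l' h => hg l' (mem_insert_of_mem h)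
    refine ⟨ops' ++ [.mulAdd o (p l) (q l)], by simp [hlen, hl], .result (ops ++ ops').length, ?_⟩
    rw [← List.append_assoc]
    refine computes_concat fun t => ?_
    rw [Op.eval, ho.eval, ((hf l (mem_insert_self l s)).append ops').eval,
      ((hg l (mem_insert_self l s)).append ops').eval, sum_insert hl, add_comm]

/-- A sum of squares of absolute values costs one operation for each term. -/
theorem exists_computes_sum_normSq {L : Type*} (s : Finset L) {ops : List (Op I)}
    {p : L → Operand I} {f : L → ι → ℂ} (hf : ∀ l ∈ s, Computes inp ops (p l) (f l)) :
    ∃ ops', ops'.length = #s ∧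
      ∃ o, Computes inp (ops ++ ops') o fun t => ∑ l ∈ s, f l t * (starRingEnd ℂ) (f l t) := by
  classical
  induction s using Finset.induction_on with
  | empty => exact ⟨[], rfl, .zero, by simpa using computes_zero inp ops⟩
  | insert l s hl ih =>
    obtain ⟨ops', hlen, o, ho⟩ := ih (fun l' h => hf l' (mem_insert_of_mem h))
    refine ⟨ops' ++ [.normSqAdd o (p l)], by simp [hlen, hl], .result (ops ++ ops').length, ?_⟩
    rw [← List.append_assoc]
    refine computes_concat fun t => ?_
    rw [Op.eval, ho.eval, ((hf l (mem_insert_self l s)).append ops').eval, sum_insert hl, add_comm]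

/-- Several values are computed one after the other. -/
theorem exists_computes_all {L : Type*} (s : Finset L) {ops : List (Op I)} {c : L → ℕ}
    {f : L → ι → ℂ}
    (h : ∀ l ops₁, ∃ ops', ops'.length ≤ c l ∧ ∃ o, Computes inp (ops ++ ops₁ ++ ops') o (f l)) :
    ∃ ops', ops'.length ≤ ∑ l ∈ s, c l ∧ ∀ l ∈ s, ∃ o, Computes inp (ops ++ ops') o (f l) := by
  classical
  induction s using Finset.induction_on with
  | empty => exact ⟨[], by simp, by simp⟩
  | insert l s hl ih =>
    obtain ⟨ops₁, hlen, hc⟩ := ih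
    obtain ⟨ops', hlen', o, ho⟩ := h l ops₁
    refine ⟨ops₁ ++ ops', ?_, ?_⟩
    · rw [List.length_append, sum_insert hl]
      omega
    · intro l' hl'
      rw [← List.append_assoc]
      rcases mem_insert.1 hl' with rfl | hl'
      · exact ⟨o, ho⟩
      · obtain ⟨o', ho'⟩ := hc l' hl'
        exact ⟨o', ho'.append ops'⟩

end Programs

/-! ### The algorithm -/

/-- The labels at level `i` of the basis vectors that can occur in the expansion of a basis vector
at level `i + 1`. -/
def Label.neighbors {n k i : ℕ} (l' : Label n k (i + 1)) : Finset (Label n k i) :=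
  open Classical in
  univ.filter fun l => l.second = (l'.second.filter fun x : Fin n => (x : ℕ) < i) ∧
    ∀ y : Fin n, i + 1 ≤ (y : ℕ) → (y ∈ l.ones ↔ y ∈ l'.ones)

/-- Only the letter at place `i` is free. This is the factor `2` in the cost. -/
theorem Label.card_neighbors_le {n k i : ℕ} (hi : i < n) (l' : Label n k (i + 1)) :
    #l'.neighbors ≤ 2 := by
  rw [← Fintype.card_bool, ← card_univ]
  refine card_le_card_of_injOn (fun l => decide ((⟨i, hi⟩ : Fin n) ∈ l.ones))
    (fun _ _ => mem_univ _) ?_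
  intro l hl m hm h
  simp only [neighbors, coe_filter, mem_univ, true_and, Set.mem_ofPred_eq] at hl hm
  refine ext_pair (Prod.ext (hl.1.trans hm.1.symm) ?_)
  ext y
  rcases lt_trichotomy (y : ℕ) i with hy | hy | hy
  · exact iff_of_false (fun h => (l.le_ones y h).not_gt hy) fun h => (m.le_ones y h).not_gt hy
  · have : y = ⟨i, hi⟩ := Fin.ext hy
    rw [this]
    simpa using h
  · exact (hl.2 y hy).trans (hm.2 y hy).symm

theorem Label.inner_eq_zero_of_notMem_neighbors {n k i : ℕ} (hi : i + 1 ≤ n)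
    {l : Label n k i} {l' : Label n k (i + 1)} (h : l ∉ l'.neighbors) {f g : FunSpace n k}
    (hf : f ∈ l'.space hi) (hg : g ∈ l.space (i.le_succ.trans hi)) : inner ℂ f g = 0 := by
  by_cases h1 : ∀ y : Fin n, i + 1 ≤ (y : ℕ) → (y ∈ l.ones ↔ y ∈ l'.ones)
  -- The second-row lengths at levels `1, ..., i` determine the entries below `i`, so tableaux that
  -- disagree are separated at one of these levels.
  · obtain ⟨j, hj1, hj, hne⟩ : ∃ j, 1 ≤ j ∧ j ≤ i ∧ l'.secondLength j ≠ l.secondLength j := by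
      by_contra! h2
      apply h
      simp only [neighbors, mem_filter, mem_univ, true_and]
      refine ⟨?_, h1⟩
      ext x
      rw [mem_filter]
      by_cases hx : (x : ℕ) < i
      · rw [← mem_iff_of_card_filter_eq h2 hx]
        simp [hx]
      · exact iff_of_false (fun h => hx (l.second_lt x h)) fun h => hx h.2
    exact inner_eq_zero_of_mem_isotypic (l'.two_mul_secondLength_le (hj.trans i.le_succ))
      (l.two_mul_secondLength_le hj) hne
      (l'.mem_isotypic_of_mem_space hi hf hj1 (hj.trans i.le_succ))
      (l.mem_isotypic_of_mem_space _ hg hj1 hj)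
  · push Not at h1
    obtain ⟨y, hy, hy'⟩ := h1
    refine inner_eq_zero_of_wordSpace hf.2 hg.2 hy (i.le_succ.trans hy) ?_
    tauto

section Algorithm

variable {n k : ℕ}

/-- The input of the algorithm, for a choice of the bases and a function. -/
def inputPair (t : IntermediateBases n k × FunSpace n k) : InputVar n k → ℂ := inputOf t.1 t.2

theorem factor_apply (B : IntermediateBases n k) (i : ℕ) (hi : i + 1 < n)
    (l' : Label n k (i + 1 + 1)) (l : Label n k (i + 1)) :
    B.factor i hi l' l =
      inner ℂ (B.basis ⟨i + 1, hi⟩ l') (B.basis ⟨i, Nat.lt_of_succ_lt hi⟩ l) := by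
  rw [IntermediateBases.factor, Module.Basis.toMatrix_apply, OrthonormalBasis.coe_toBasis_repr_apply,
    OrthonormalBasis.repr_apply_apply]

/-- A row of the change of basis applied to the old coordinates, with only the entries that can be
nonzero. -/
theorem inner_basis_succ (B : IntermediateBases n k) (f : FunSpace n k) (i : ℕ) (hi : i + 1 < n)
    (l' : Label n k (i + 1 + 1)) :
    inner ℂ (B.basis ⟨i + 1, hi⟩ l') f = ∑ l ∈ l'.neighbors,
      B.factor i hi l' l * inner ℂ (B.basis ⟨i, Nat.lt_of_succ_lt hi⟩ l) f := by
  have h := (B.basis ⟨i, Nat.lt_of_succ_lt hi⟩).sum_inner_mul_inner (B.basis ⟨i + 1, hi⟩ l') f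
  rw [← h]
  refine (sum_subset (subset_univ l'.neighbors) fun l _ hl => ?_).symm.trans
    (sum_congr rfl fun l _ => ?_)
  · have h0 := Label.inner_eq_zero_of_notMem_neighbors hi hl (B.mem_space ⟨i + 1, hi⟩ l')
      (B.mem_space ⟨i, Nat.lt_of_succ_lt hi⟩ l)
    rw [h0, zero_mul]
  · rw [factor_apply]

theorem inner_delta (x : KSet n k) (f : FunSpace n k) : inner ℂ (delta x) f = f x := by
  classical
  simp [delta, EuclideanSpace.inner_single_left]

theorem delta_mem_wordSpace {i : ℕ} {l : Label n k i} {x : KSet n k} (h : delta x ∈ l.wordSpace) :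
    ∀ y : Fin n, i ≤ (y : ℕ) → (y ∈ x ↔ y ∈ l.ones) :=
  Label.mem_wordSpace.1 h x (by simp [delta])

/-- One program must serve all choices of bases. `IntermediateBases.first` lets the `k`-set depend
on the choice, but the word of the label pins it down, so any fixed `B₀` reveals which input to
read. -/
theorem computes_first (hn : 0 < n) (l : Label n k (0 + 1)) :
    ∃ o, Computes (inputPair (n := n) (k := k)) [] o fun t => inner ℂ (t.1.basis ⟨0, hn⟩ l) t.2 := by
  obtain ⟨B₀⟩ := nonempty_intermediateBases n k
  obtain ⟨x, hx⟩ := B₀.first hn l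
  refine ⟨.input (.coord x), fun t r => ?_⟩
  obtain ⟨x', hx'⟩ := t.1.first hn l
  have h0 : delta x ∈ l.wordSpace := hx ▸ (B₀.mem_space ⟨0, hn⟩ l).2
  have h1 : delta x' ∈ l.wordSpace := hx' ▸ (t.1.mem_space ⟨0, hn⟩ l).2
  have h2 : x' = x := Label.kset_ext fun y hy =>
    (delta_mem_wordSpace h1 y hy).trans (delta_mem_wordSpace h0 y hy).symm
  simp only [hx', inner_delta, h2]
  rfl

/-- The coordinates in the bases are computed one basis after the other. -/
theorem computes_coordinates (i : ℕ) (hi : i < n) :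
    ∃ ops : List (Op (InputVar n k)), ops.length ≤ 2 * i * n.choose k ∧
      ∀ l, ∃ o, Computes inputPair ops o fun t => inner ℂ (t.1.basis ⟨i, hi⟩ l) t.2 := by
  induction i with
  | zero => exact ⟨[], by simp, computes_first hi⟩
  | succ i ih =>
    obtain ⟨ops, hlen, hc⟩ := ih (Nat.lt_of_succ_lt hi)
    choose o ho using hc
    obtain ⟨ops', hlen', hc'⟩ := exists_computes_all (univ : Finset (Label n k (i + 1 + 1)))
      (inp := inputPair) (ops := ops) (c := fun _ => 2)
      (f := fun l' t => inner ℂ (t.1.basis ⟨i + 1, hi⟩ l') t.2) (by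
        intro l' ops₁
        obtain ⟨ops', hlen', o', ho'⟩ := exists_computes_sum_mul l'.neighbors
          (inp := inputPair) (ops := ops ++ ops₁) (p := fun l => .input (.entry i hi l' l)) (q := o)
          (f := fun l t => t.1.factor i hi l' l)
          (g := fun l t => inner ℂ (t.1.basis ⟨i, Nat.lt_of_succ_lt hi⟩ l) t.2)
          (fun l _ t r => rfl) (fun l _ => (ho l).append ops₁)
        refine ⟨ops', hlen'.trans_le (l'.card_neighbors_le hi), o', ?_⟩
        simpa only [inner_basis_succ] using ho')
    refine ⟨ops ++ ops', ?_, fun l => hc' l (mem_univ l)⟩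
    -- Two operations for each of the `n.choose k` labels of the new basis.
    rw [sum_const, card_univ, Label.card_eq_choose k (by omega) hi, smul_eq_mul] at hlen'
    rw [List.length_append]
    calc _ ≤ 2 * i * n.choose k + n.choose k * 2 := Nat.add_le_add hlen hlen'
      _ = _ := by ring

end Algorithm

end JohnsonFFT

end

/-! ### Correctness and cost of the program -/

theorem mainTheorem4 (n k : ℕ) (hn : 1 ≤ n) (hk : k ≤ n) :
    (∀ f : JohnsonFFT.FunSpace n k, ∃! g, JohnsonFFT.IsDecomposition f g) ∧
    Nonempty (JohnsonFFT.IntermediateBases n k) ∧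
    ∃ P : JohnsonFFT.Program (JohnsonFFT.InputVar n k) (Fin (min k (n - k) + 1)),
      P.cost ≤ (2 * n - 1) * n.choose k ∧
      ∀ (B : JohnsonFFT.IntermediateBases n k) (f : JohnsonFFT.FunSpace n k)
        (g : Fin (min k (n - k) + 1) → JohnsonFFT.FunSpace n k),
        JohnsonFFT.IsDecomposition f g →
        ∀ a, P.run (JohnsonFFT.inputOf B f) a = ((‖g a‖ ^ 2 : ℝ) : ℂ) := by
  open JohnsonFFT in
  -- From here on the ground set has `n + 1` elements, so the last basis has index `n`, after `n`
  -- changes of basis.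
  obtain ⟨n, rfl⟩ : ∃ m, n = m + 1 := ⟨n - 1, by omega⟩
  have htop : ∀ (B : IntermediateBases (n + 1) k) (f : FunSpace (n + 1) k),
      IsDecomposition f fun a : Fin (min k (n + 1 - k) + 1) =>
        component (B.basis ⟨n, n.lt_succ_self⟩) f a :=
    fun B f => isDecomposition_component hn _ (B.mem_space ⟨n, n.lt_succ_self⟩) f
  refine ⟨fun f => ?_, nonempty_intermediateBases _ _, ?_⟩
  · obtain ⟨B⟩ := nonempty_intermediateBases (n + 1) k
    exact ⟨_, htop B f, fun g hg => hg.unique (htop B f)⟩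
  · obtain ⟨ops, hlen, hc⟩ := computes_coordinates (k := k) n n.lt_succ_self
    choose o ho using hc
    obtain ⟨ops', hlen', hc'⟩ := exists_computes_all
      (Finset.univ : Finset (Fin (min k (n + 1 - k) + 1))) (inp := inputPair) (ops := ops)
      (c := fun a => (Finset.univ.filter fun l : Label (n + 1) k (n + 1) =>
        l.second.card = (a : ℕ)).card)
      (f := fun a t => ((‖component (t.1.basis ⟨n, n.lt_succ_self⟩) t.2 a‖ ^ 2 : ℝ) : ℂ)) (by
        intro a ops₁
        obtain ⟨ops', hlen', o', ho'⟩ := exists_computes_sum_normSq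
          (Finset.univ.filter fun l : Label (n + 1) k (n + 1) => l.second.card = (a : ℕ))
          (inp := inputPair) (ops := ops ++ ops₁) (fun l _ => (ho l).append ops₁)
        refine ⟨ops', hlen'.le, o', ?_⟩
        simpa only [norm_component_sq] using ho')
    choose out hout using hc'
    refine ⟨⟨ops ++ ops', fun a => out a (Finset.mem_univ a)⟩, ?_, fun B f g hg a => ?_⟩
    -- The shapes partition the labels of the last basis, so all the weights together use each
    -- coordinate once.
    · have hsum : ∑ a : Fin (min k (n + 1 - k) + 1), (Finset.univ.filter
          fun l : Label (n + 1) k (n + 1) => l.second.card = (a : ℕ)).card =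
          (n + 1).choose k := by
        rw [Fin.sum_univ_eq_sum_range (fun a => (Finset.univ.filter
          fun l : Label (n + 1) k (n + 1) => l.second.card = a).card),
          ← Finset.card_eq_sum_card_fiberwise, Finset.card_univ,
          Label.card_eq_choose k hn le_rfl]
        intro l _
        rw [Finset.mem_coe, Finset.mem_range]
        exact Nat.lt_succ_of_le l.card_second_le_min
      rw [hsum] at hlen'
      rw [Program.cost, List.length_append]
      calc _ ≤ 2 * n * (n + 1).choose k + (n + 1).choose k := Nat.add_le_add hlen hlen'
        _ = (2 * (n + 1) - 1) * (n + 1).choose k := by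
          rw [show 2 * (n + 1) - 1 = 2 * n + 1 by omega]
          ring
    · rw [hg.unique (htop B f)]
      exact (hout a (Finset.mem_univ a)).eval (B, f)
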